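/- Let $r\ge 1$ and let $f\in\mathbb{C}[z_1^{\pm1},\dots,z_r^{\pm1}]$ be a Laurent polynomial with zero locus $Z_f\subset(\mathbb{C}^*)^r$. Let $\mathcal{A}_f=\{(\log|z_1|,\dots,\log|z_r|) : z\in Z_f\}\subset\mathbb{R}^r$ be its amoeba. For a positive integer $n$, let $$f_n(z)=\prod_{k_1=0}^{n-1}\cdots\prod_{k_r=0}^{n-1} f\big(e^{2\pi i k_1/n}z_1,\dots,e^{2\pi i k_r/n}z_r\big)$$ be the $n$-th cyclic resultant of $f$. For a Laurent polynomial $g$, written as the sum $g=m_1+\dots+m_N$ of its nonzero monomials, and $\mathbf{a}\in\mathbb{R}^r$, let $g\{\mathbf{a}\}$ be the list of positive numbers $|m_1(z)|,\dots,|m_N(z)|$, where $z$ is any point with $\log|z_i|=a_i$ for all $i$. A finite list of positive numbers is called *lopsided* if one of its entries is greater than the sum of all the others. A list $b_1,\dots,b_{D+1}$ of positive numbers is called *$d'$-superlopsided*, where $d'\ge D$ is a real number, if there is an $i$ with $b_i>d'b_j$ for all $j\ne i$ (in particular, being $d'$-superlopsided includes the requirement $d'\ge D$); it is called *superlopsided*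 if it is $D$-superlopsided. Let $\Delta(f)\subset\mathbb{R}^r$ be the Newton polytope of $f$, that is, the convex hull of the exponent vectors of the monomials of $f$. Let $c=\max_{1\le i\le r}\big(\max_{x\in\Delta(f)}x_i-\min_{x\in\Delta(f)}x_i\big)$, and let $d$ be any real number such that $\#\big(\mathbb{Z}^r\cap m\Delta(f)\big)/m^r\le d$ for all positive integers $m$. **Theorem.** Let $\varepsilon>0$, let $\mathbf{a}\in\mathbb{R}^r\setminus\mathcal{A}_f$ be a point whose Euclidean distance from $\mathcal{A}_f$ is at least $\varepsilon$ (the distance from the empty set being $+\infty$), and let $n$ be a positive integer. 1. If $n\varepsilon\ge(r-1)\log n+\log\big((r+3)2^{r+1}c\big)$, then $f_n\{\mathbf{a}\}$ is lopsided. 2. If $n\varepsilon\ge(r^2-1)\log n+\log\big(\tfrac{16}{3}cd\big)$, then $f_n\{\mathbf{a}\}$ is superlopsided, and in fact it is $(d\,n^{r^2-r})$-superlopsided. (If $c=0$, we read $\log 0=-\infty$, so that both conditions on $n$ hold.) -/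

import Mathlib

open scoped Pointwise

noncomputable section

namespace CyclicAmoeba

/-- Laurent polynomials in `r` variables over `ℂ`: finitely supported families of coefficients
indexed by exponent vectors in `ℤ^r`, with the convolution product. -/
abbrev LaurentPoly (r : ℕ) : Type := AddMonoidAlgebra ℂ (Fin r → ℤ)

variable {r : ℕ}

/-- The Laurent monomial `b z₁^{k₁} ⋯ z_r^{k_r}`, evaluated at `z`. -/
def evalMonomial (k : Fin r → ℤ) (b : ℂ) (z : Fin r → ℂ) : ℂ :=
  b * ∏ i, z i ^ k i

/-- The value of `f` at a point `z` (meaningful when all coordinates of `z` are nonzero). -/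
def eval (f : LaurentPoly r) (z : Fin r → ℂ) : ℂ :=
  ∑ k ∈ f.coeff.support, evalMonomial k (f.coeff k) z

/-- The zero locus of `f` in the torus `(ℂ^*)^r`. -/
def zeroLocus (f : LaurentPoly r) : Set (Fin r → ℂ) :=
  {z | (∀ i, z i ≠ 0) ∧ eval f z = 0}

/-- `Log z = (log |z₁|, …, log |z_r|)`. -/
def logMap (z : Fin r → ℂ) : EuclideanSpace ℝ (Fin r) :=
  WithLp.toLp 2 fun i => Real.log ‖z i‖

/-- The amoeba of `f`, a subset of Euclidean space. -/
def amoeba (f : LaurentPoly r) : Set (EuclideanSpace ℝ (Fin r)) :=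
  logMap '' zeroLocus f

/-- The Laurent polynomial `f (u₁ z₁, …, u_r z_r)`. -/
def rescale (u : Fin r → ℂ) (f : LaurentPoly r) : LaurentPoly r :=
  ∑ k ∈ f.coeff.support, AddMonoidAlgebra.single k (evalMonomial k (f.coeff k) u)

/-- The cyclic resultant `f_n (z) = ∏_{k₁ < n} ⋯ ∏_{k_r < n}
f (e^{2 π i k₁ / n} z₁, …, e^{2 π i k_r / n} z_r)`. -/
def cyclicResultant (f : LaurentPoly r) (n : ℕ) : LaurentPoly r :=
  ∏ k : Fin r → Fin n,
    rescale (fun i => Complex.exp (2 * Real.pi * Complex.I * ((k i : ℕ) : ℂ) / (n : ℂ))) f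

/-- The list `f{a}` of the absolute values of the monomials occurring in `f` at a point of
`Log⁻¹ a`; the point used is `(e^{a₁}, …, e^{a_r})`. The list is indexed by the exponent
vectors of these monomials. -/
def termSizes (f : LaurentPoly r) (a : EuclideanSpace ℝ (Fin r)) : f.coeff.support → ℝ :=
  fun k => ‖evalMonomial k.1 (f.coeff k.1) (fun i => (Real.exp (a i) : ℂ))‖

/-- A list is lopsided if one of its entries is greater than the sum of all the others. -/
def IsLopsided {ι : Type*} [Fintype ι] [DecidableEq ι] (b : ι → ℝ) : Prop :=
  ∃ i, ∑ j ∈ Finset.univ.erase i, b j < b i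

/-- A list of `d + 1` entries, where `d ≤ d'`, is `d'`-superlopsided if one of its entries is
greater than `d'` times each of the others. -/
def IsSuperlopsidedWith {ι : Type*} [Fintype ι] (d' : ℝ) (b : ι → ℝ) : Prop :=
  (Fintype.card ι : ℝ) ≤ d' + 1 ∧ ∃ i, ∀ j, j ≠ i → d' * b j < b i

/-- A list of `d + 1` entries is superlopsided if it is `d`-superlopsided. -/
def IsSuperlopsided {ι : Type*} [Fintype ι] (b : ι → ℝ) : Prop :=
  IsSuperlopsidedWith ((Fintype.card ι : ℝ) - 1) b

/-- The Newton polytope: the convex hull of the exponent vectors of the monomials of `f`. -/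
def newtonPolytope (f : LaurentPoly r) : Set (Fin r → ℝ) :=
  convexHull ℝ ((fun (k : Fin r → ℤ) (i : Fin r) => (k i : ℝ)) '' (f.coeff.support : Set (Fin r → ℤ)))

/-- The number of integral points of a bounded set in `ℝ^r`. -/
def latticePointCount (S : Set (Fin r → ℝ)) : ℕ :=
  {k : Fin r → ℤ | (fun i => (k i : ℝ)) ∈ S}.ncard

/-- `d` is an upper bound on `#(ℤ^r ∩ m Δ) / m^r`, over all positive integers `m`. -/
def IsLatticeBound (Δ : Set (Fin r → ℝ)) (d : ℝ) : Prop :=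
  ∀ m : ℕ, 0 < m → (latticePointCount ((m : ℝ) • Δ) : ℝ) / (m : ℝ) ^ r ≤ d

/-- `c_i(f) = max x_i(Δ(f)) - min x_i(Δ(f))`. -/
def coordWidth (f : LaurentPoly r) (i : Fin r) : ℝ :=
  sSup ((fun x : Fin r → ℝ => x i) '' newtonPolytope f) -
    sInf ((fun x : Fin r → ℝ => x i) '' newtonPolytope f)

/-- `c = max {c_i(f) | 1 ≤ i ≤ r}`. -/
def maxWidth (f : LaurentPoly r) : ℝ :=
  ⨆ i, coordWidth f i

end CyclicAmoeba

end

noncomputable section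

namespace CyclicAmoeba

variable {r : ℕ}

/-! Vary only `z_i`, starting over a point at distance at most `τ` from `a`. The resulting Laurent
polynomial in `z_i` has at most `c` nonzero roots, all outside an annulus of logarithmic half-width
`δ = ε - τ`, because `f` has no zero over the ball of radius `ε` about `a`. The product over the
rotations of `z_i` by `n`-th roots of unity turns each factor `α - z_i` into `α^n - z_i^n`, where
one term outweighs the other by a factor at least `e^{nδ}`. The rotations of the other coordinates
give `n^{r-1}` such products, so on the circle `f_n` is a monomial in `z_i` up to a relative error
`e^s - 1` with `s = n^{r-1} c e^{-nδ}` (`nearMonomial_cyclicResultant`).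

By Parseval, the coefficients of `f_n` as a Laurent polynomial in `z_i` are then concentrated, in
the square-sum sense, on one exponent `M_i` (`NearMonomial.exists_dominant`). Continuity and
connectedness make `M_i` the same over the whole ball of radius `τ`, and averaging over the torus
passes from these coefficients to the individual terms of `f_n` (`exists_dominant_exponent`). The
`r` directions together single out one exponent vector `M`.

It remains to leave the square-sum norm. For superlopsidedness `τ = 0` suffices, since `f_n` has at
most `d n^{r^2-r}` terms (`card_support_cyclicResultant_le`, `mul_lt_of_concentrated`). Lopsidedness
needs no such count: concentration over a ball of suitable radius `τ` makes the terms decay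
geometrically away from `M`, as the exponents lie in `nℤ^r`, and Cauchy–Schwarz sums them
(`sum_erase_lt_of_concentrated`). -/

/-! ### Evaluation and rescaling in logarithmic coordinates on the torus. -/

/-- The character `k ↦ exp (∑ kⱼ ξⱼ)` of the lattice of exponents. -/
def expChar (ξ : Fin r → ℂ) : Multiplicative (Fin r → ℤ) →* ℂ where
  toFun k := Complex.exp (∑ j, (k.toAdd j : ℂ) * ξ j)
  map_one' := by simp
  map_mul' k l := by
    simp [← Complex.exp_add, ← Finset.sum_add_distrib, add_mul]

/-- Evaluation of a Laurent polynomial at the point `(exp ξ₁, …, exp ξ_r)` of the torus. -/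
def expEval (ξ : Fin r → ℂ) : LaurentPoly r →ₐ[ℂ] ℂ :=
  AddMonoidAlgebra.lift ℂ ℂ _ (expChar ξ)

/-- Rescaling by the point `(exp η₁, …, exp η_r)` of the torus, as an algebra homomorphism. -/
def expRescale (η : Fin r → ℂ) : LaurentPoly r →ₐ[ℂ] LaurentPoly r :=
  AddMonoidAlgebra.lift ℂ (LaurentPoly r) _
    { toFun := fun k => AddMonoidAlgebra.single k.toAdd (expChar η k)
      map_one' := by simp [AddMonoidAlgebra.one_def]
      map_mul' := fun k l => by
        rw [AddMonoidAlgebra.single_mul_single, (expChar η).map_mul, toAdd_mul] }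

lemma expEval_single (ξ : Fin r → ℂ) (k : Fin r → ℤ) (b : ℂ) :
    expEval ξ (AddMonoidAlgebra.single k b) = b * Complex.exp (∑ j, (k j : ℂ) * ξ j) := by
  have := AddMonoidAlgebra.lift_single (expChar ξ) k b
  exact this

lemma expRescale_single (η : Fin r → ℂ) (k : Fin r → ℤ) (b : ℂ) :
    expRescale η (AddMonoidAlgebra.single k b) =
      AddMonoidAlgebra.single k (b * Complex.exp (∑ j, (k j : ℂ) * η j)) := by
  have := AddMonoidAlgebra.lift_single (A := LaurentPoly r)
    { toFun := fun k : Multiplicative (Fin r → ℤ) =>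
        AddMonoidAlgebra.single k.toAdd (expChar η k)
      map_one' := by simp [AddMonoidAlgebra.one_def]
      map_mul' := fun k l => by
        rw [AddMonoidAlgebra.single_mul_single, (expChar η).map_mul, toAdd_mul] } k b
  refine this.trans ?_
  ext l
  simp [expChar, Finsupp.single_apply]

lemma sum_single_coeff (f : LaurentPoly r) :
    ∑ k ∈ f.coeff.support, AddMonoidAlgebra.single k (f.coeff k) = f :=
  AddMonoidAlgebra.sum_coeff_single f

lemma expEval_eq_sum (ξ : Fin r → ℂ) (f : LaurentPoly r) :
    expEval ξ f = ∑ k ∈ f.coeff.support, f.coeff k * Complex.exp (∑ j, (k j : ℂ) * ξ j) := by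
  conv_lhs => rw [← sum_single_coeff f]
  rw [map_sum]
  exact Finset.sum_congr rfl fun k _ => expEval_single ξ k _

lemma evalMonomial_exp (k : Fin r → ℤ) (b : ℂ) (ξ : Fin r → ℂ) :
    evalMonomial k b (fun i => Complex.exp (ξ i)) =
      b * Complex.exp (∑ j, (k j : ℂ) * ξ j) := by
  simp [evalMonomial, Complex.exp_sum, Complex.exp_int_mul]

lemma eval_exp (f : LaurentPoly r) (ξ : Fin r → ℂ) :
    eval f (fun i => Complex.exp (ξ i)) = expEval ξ f := by
  simp only [eval, evalMonomial_exp, expEval_eq_sum]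

lemma rescale_exp (f : LaurentPoly r) (η : Fin r → ℂ) :
    rescale (fun i => Complex.exp (η i)) f = expRescale η f := by
  conv_rhs => rw [← sum_single_coeff f]
  rw [map_sum]
  simp only [rescale, evalMonomial_exp, expRescale_single]

lemma coeff_expRescale (η : Fin r → ℂ) (f : LaurentPoly r) (k : Fin r → ℤ) :
    (expRescale η f).coeff k = f.coeff k * Complex.exp (∑ j, (k j : ℂ) * η j) := by
  induction f using AddMonoidAlgebra.induction_linear with
  | zero => simp
  | add f g hf hg => simp [hf, hg, add_mul]
  | single l b =>
    rw [expRescale_single]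
    by_cases h : l = k
    · subst h; simp
    · simp [h]

lemma expEval_expRescale (ξ η : Fin r → ℂ) (f : LaurentPoly r) :
    expEval ξ (expRescale η f) = expEval (ξ + η) f := by
  induction f using AddMonoidAlgebra.induction_linear with
  | zero => simp
  | add f g hf hg => simp [hf, hg]
  | single l b =>
    rw [expRescale_single, expEval_single, expEval_single, mul_assoc, ← Complex.exp_add,
      ← Finset.sum_add_distrib, add_comm]
    simp [mul_add, add_comm]

lemma expRescale_expRescale (ξ η : Fin r → ℂ) (f : LaurentPoly r) :
    expRescale ξ (expRescale η f) = expRescale (ξ + η) f := by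
  ext k
  simp only [coeff_expRescale, mul_assoc, ← Complex.exp_add, ← Finset.sum_add_distrib]
  simp [mul_add, add_comm]

/-! ### Exponents of the cyclic resultant: divisibility by `n`, location and number. -/

/-- The vector `2 π i k / n`. -/
def rootAngle (n : ℕ) (k : Fin r → Fin n) : Fin r → ℂ :=
  fun i => 2 * Real.pi * Complex.I * ((k i : ℕ) : ℂ) / (n : ℂ)

lemma cyclicResultant_eq (f : LaurentPoly r) (n : ℕ) :
    cyclicResultant f n = ∏ k : Fin r → Fin n, expRescale (rootAngle n k) f :=
  Finset.prod_congr rfl fun k _ => rescale_exp f (rootAngle n k)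

lemma expEval_cyclicResultant (ξ : Fin r → ℂ) (f : LaurentPoly r) (n : ℕ) :
    expEval ξ (cyclicResultant f n) = ∏ k : Fin r → Fin n, expEval (ξ + rootAngle n k) f := by
  simp [cyclicResultant_eq, expEval_expRescale]

lemma expRescale_congr {η η' : Fin r → ℂ} (h : ∀ i, Complex.exp (η i) = Complex.exp (η' i))
    (f : LaurentPoly r) : expRescale η f = expRescale η' f := by
  rw [← rescale_exp, ← rescale_exp]
  simp only [h]

/-- Rotating one coordinate by a primitive `n`-th root of unity only permutes the factors. -/
lemma expRescale_cyclicResultant (f : LaurentPoly r) (n : ℕ) (hn : 0 < n) (i : Fin r) :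
    expRescale (Pi.single i (2 * Real.pi * Complex.I / n)) (cyclicResultant f n) =
      cyclicResultant f n := by
  have : NeZero n := ⟨hn.ne'⟩
  have hn' : (n : ℂ) ≠ 0 := by exact_mod_cast hn.ne'
  rw [cyclicResultant_eq, map_prod,
    ← Equiv.prod_comp (Equiv.addRight (Pi.single i (1 : Fin n) : Fin r → Fin n))
      (fun k : Fin r → Fin n => expRescale (rootAngle n k) f)]
  refine Finset.prod_congr rfl fun k _ => ?_
  rw [expRescale_expRescale]
  refine expRescale_congr (fun j => ?_) f
  by_cases h : j = i
  · subst h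
    have h1 : (((k + Pi.single j 1 : Fin r → Fin n) j : Fin n) : ℕ) = ((k j : ℕ) + 1) % n := by
      rw [Pi.add_apply, Pi.single_eq_same, Fin.val_add, Fin.val_one', Nat.add_mod_mod]
    have key : ((((k j : ℕ) + 1) % n : ℕ) : ℂ) + n * (((k j : ℕ) + 1) / n : ℕ) = (k j : ℕ) + 1 := by
      exact_mod_cast Nat.mod_add_div ((k j : ℕ) + 1) n
    rw [Complex.exp_eq_exp_iff_exists_int]
    -- The carry of the addition modulo `n` is the number of full turns by which the two angles
    -- differ.
    refine ⟨(((k j : ℕ) + 1) / n : ℕ), ?_⟩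
    simp only [Pi.add_apply, Pi.single_eq_same, rootAngle, Equiv.coe_addRight] at h1 ⊢
    rw [h1, Int.cast_natCast]
    field_simp
    linear_combination -key
  · simp [rootAngle, h]

/-- Rotational invariance multiplies the coefficient at `k` by `e^{2πi k_i/n}`, which must be `1`
when the coefficient is nonzero. -/
lemma dvd_of_mem_support_cyclicResultant (f : LaurentPoly r) (n : ℕ) (hn : 0 < n)
    {k : Fin r → ℤ} (hk : k ∈ (cyclicResultant f n).coeff.support) (i : Fin r) :
    (n : ℤ) ∣ k i := by
  have hn' : (n : ℂ) ≠ 0 := by exact_mod_cast hn.ne'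
  have h := congrArg (fun g : LaurentPoly r => g.coeff k) (expRescale_cyclicResultant f n hn i)
  simp only [coeff_expRescale] at h
  have h1 := mul_left_cancel₀ (Finsupp.mem_support_iff.mp hk) (h.trans (mul_one _).symm)
  rw [Complex.exp_eq_one_iff] at h1
  obtain ⟨m, hm⟩ := h1
  have h2 : ∑ j, (k j : ℂ) * (Pi.single i (2 * Real.pi * Complex.I / n) : Fin r → ℂ) j =
      k i * (2 * Real.pi * Complex.I / n) := by
    rw [Finset.sum_eq_single i] <;> simp +contextual
  rw [h2] at hm
  have h3 : (k i : ℂ) = n * m := by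
    have := Complex.two_pi_I_ne_zero
    field_simp at hm
    linear_combination hm
  exact ⟨m, by exact_mod_cast h3⟩

lemma cast_mem_newtonPolytope {f : LaurentPoly r} {k : Fin r → ℤ} (hk : k ∈ f.coeff.support) :
    (fun i => (k i : ℝ)) ∈ newtonPolytope f :=
  subset_convexHull ℝ _ ⟨k, hk, rfl⟩

/-- Exponents of a product add, and by convexity a Minkowski sum of `m` copies of the polytope is
its `m`-th dilate. Nonemptiness serves the empty product, where the dilate by `0` has to contain the
origin. -/
lemma support_prod_expRescale {ι : Type*} (f : LaurentPoly r)
    (hf : (newtonPolytope f).Nonempty) (s : Finset ι)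
    (η : ι → Fin r → ℂ) {k : Fin r → ℤ}
    (hk : k ∈ (∏ u ∈ s, expRescale (η u) f).coeff.support) :
    (fun i => (k i : ℝ)) ∈ (s.card : ℝ) • newtonPolytope f := by
  classical
  induction s using Finset.induction_on generalizing k with
  | empty =>
    have : k = 0 := by
      by_contra h
      exact (Finsupp.mem_support_iff.mp hk) (by
        simp [AddMonoidAlgebra.one_def, Ne.symm h])
    subst this
    simp [Set.zero_smul_set hf]
    rfl
  | insert u s hu ih =>
    rw [Finset.prod_insert hu] at hk
    obtain ⟨k₁, h₁, k₂, h₂, rfl⟩ := Finset.mem_add.mp (AddMonoidAlgebra.support_coeff_mul_subset _ _ hk)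
    have h₁' : k₁ ∈ f.coeff.support := by
      rw [Finsupp.mem_support_iff, coeff_expRescale] at h₁
      exact Finsupp.mem_support_iff.mpr (left_ne_zero_of_mul h₁)
    have hconv : Convex ℝ (newtonPolytope f) := convex_convexHull ℝ _
    rw [Finset.card_insert_of_notMem hu, Nat.cast_add, Nat.cast_one,
      hconv.add_smul (Nat.cast_nonneg _) zero_le_one, one_smul]
    refine Set.mem_add.mpr ⟨_, ih h₂, _, cast_mem_newtonPolytope h₁', ?_⟩
    ext i
    simp [add_comm]

lemma isBounded_newtonPolytope (f : LaurentPoly r) :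
    Bornology.IsBounded (newtonPolytope f) :=
  ((f.coeff.support.finite_toSet.image _).isCompact_convexHull ℝ).isBounded

lemma finite_lattice_of_isBounded {S : Set (Fin r → ℝ)} (hS : Bornology.IsBounded S) :
    {k : Fin r → ℤ | (fun i => (k i : ℝ)) ∈ S}.Finite := by
  obtain ⟨R, hR⟩ := hS.exists_norm_le
  refine (Set.finite_Icc (fun _ => -⌈R⌉ : Fin r → ℤ) (fun _ => ⌈R⌉)).subset fun k hk => ?_
  have h : ∀ i, |(k i : ℝ)| ≤ ⌈R⌉ := fun i =>
    ((norm_le_pi_norm (fun i => (k i : ℝ)) i).trans (hR _ hk)).trans (Int.le_ceil R)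
  exact ⟨fun i => by exact_mod_cast (abs_le.mp (h i)).1,
    fun i => by exact_mod_cast (abs_le.mp (h i)).2⟩

/-- The `n^r` factors put the support into the dilate by `n^r`. All exponents being divisible by
`n`, division by `n` injects it into the lattice points of the dilate by `n^{r-1}`. -/
lemma card_support_cyclicResultant_le (hr : 0 < r) (f : LaurentPoly r) (hf : f ≠ 0) (n : ℕ)
    (hn : 0 < n) {d : ℝ} (hd : IsLatticeBound (newtonPolytope f) d) :
    ((cyclicResultant f n).coeff.support.card : ℝ) ≤ d * (n : ℝ) ^ (r ^ 2 - r) := by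
  have hne : (newtonPolytope f).Nonempty := by
    obtain ⟨k, hk⟩ : f.coeff.support.Nonempty := by
      simpa [Finset.nonempty_iff_ne_empty] using hf
    exact ⟨_, cast_mem_newtonPolytope hk⟩
  have hn' : (0 : ℝ) < n := by exact_mod_cast hn
  have hm : 0 < n ^ (r - 1) := by positivity
  have h1 := hd _ hm
  rw [div_le_iff₀ (by positivity)] at h1
  have hpow : (((n ^ (r - 1) : ℕ) : ℝ)) ^ r = (n : ℝ) ^ (r ^ 2 - r) := by
    push_cast
    rw [← pow_mul]
    congr 1
    rw [sq, Nat.sub_mul, one_mul]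
  rw [hpow] at h1
  refine le_trans ?_ h1
  unfold latticePointCount
  rw [Nat.cast_le, ← Set.ncard_coe_finset]
  set S := (cyclicResultant f n).coeff.support
  refine Set.ncard_le_ncard_of_injOn (fun k i => k i / (n : ℤ)) (fun k hk => ?_) ?_
    (finite_lattice_of_isBounded ((isBounded_newtonPolytope f).smul₀ _))
  · have hk' : k ∈ S := hk
    have hdv := dvd_of_mem_support_cyclicResultant f n hn hk'
    have hmem : k ∈ (∏ u : Fin r → Fin n, expRescale (rootAngle n u) f).coeff.support := by
      rw [← cyclicResultant_eq]; exact hk'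
    obtain ⟨x, hx, hxk⟩ := support_prod_expRescale f hne Finset.univ (rootAngle n) hmem
    refine ⟨x, hx, ?_⟩
    ext i
    have hi : (((k i / (n : ℤ) : ℤ)) : ℝ) * n = k i := by
      exact_mod_cast Int.ediv_mul_cancel (hdv i)
    have h2 := congrFun hxk i
    simp only [Pi.smul_apply, smul_eq_mul, Finset.card_univ, Fintype.card_fun, Fintype.card_fin]
      at h2 ⊢
    have h3 : ((n ^ r : ℕ) : ℝ) = (n ^ (r - 1) : ℕ) * n := by
      rw [← Nat.cast_mul, ← pow_succ, Nat.sub_add_cancel hr]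
    rw [h3, ← hi] at h2
    exact mul_right_cancel₀ hn'.ne' (by rw [← h2]; ring)
  · intro k hk l hl hkl
    ext i
    have := congrFun hkl i
    rw [← Int.ediv_mul_cancel (dvd_of_mem_support_cyclicResultant f n hn hk i),
      ← Int.ediv_mul_cancel (dvd_of_mem_support_cyclicResultant f n hn hl i)]
    exact congrArg (· * (n : ℤ)) this

/-- The extent of the support in each coordinate is at most `maxWidth f`. -/
lemma sub_le_maxWidth (f : LaurentPoly r) {k l : Fin r → ℤ} (hk : k ∈ f.coeff.support)
    (hl : l ∈ f.coeff.support) (i : Fin r) : ((k i - l i : ℤ) : ℝ) ≤ maxWidth f := by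
  have hb : Bornology.IsBounded ((fun x : Fin r → ℝ => x i) '' newtonPolytope f) :=
    ((isBounded_newtonPolytope f).image_eval i)
  have h1 := le_csSup hb.bddAbove ⟨_, cast_mem_newtonPolytope hk, rfl⟩
  have h2 := csInf_le hb.bddBelow ⟨_, cast_mem_newtonPolytope hl, rfl⟩
  have h3 : coordWidth f i ≤ maxWidth f := le_ciSup (Set.finite_range _).bddAbove i
  push_cast
  unfold coordWidth at h3
  linarith

/-! ### Functions close to a monomial on a circle. -/

/-- On the imaginary axis `F w` is a nonzero monomial in `exp w`, up to a relative error of at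
most `exp s - 1`. -/
def NearMonomial (s : ℝ) (F : ℂ → ℂ) : Prop :=
  ∃ C : ℂ, C ≠ 0 ∧ ∃ M : ℤ, ∃ h : ℂ → ℂ, ∀ w : ℂ, w.re = 0 →
    F w = C * Complex.exp (M * w) * (1 + h w) ∧ ‖h w‖ ≤ Real.exp s - 1

lemma NearMonomial.mono {s t : ℝ} {F : ℂ → ℂ} (hF : NearMonomial s F) (hst : s ≤ t) :
    NearMonomial t F := by
  obtain ⟨C, hC, M, h, H⟩ := hF
  exact ⟨C, hC, M, h, fun w hw => ⟨(H w hw).1, (H w hw).2.trans (by gcongr)⟩⟩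

lemma NearMonomial.monomial {C : ℂ} (hC : C ≠ 0) (m : ℤ) :
    NearMonomial 0 (fun w => C * Complex.exp (m * w)) :=
  ⟨C, hC, m, 0, fun w _ => by simp⟩

/-- The error is measured as `exp s - 1` so that `s` is additive: `(1 + h)(1 + k) - 1` has norm at
most `e^s e^t - 1`. -/
lemma NearMonomial.mul {s t : ℝ} {F G : ℂ → ℂ} (hF : NearMonomial s F) (hG : NearMonomial t G) :
    NearMonomial (s + t) (fun w => F w * G w) := by
  obtain ⟨C, hC, M, h, H⟩ := hF
  obtain ⟨D, hD, N, k, K⟩ := hG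
  refine ⟨C * D, mul_ne_zero hC hD, M + N, fun w => (1 + h w) * (1 + k w) - 1, fun w hw => ?_⟩
  obtain ⟨h1, h2⟩ := H w hw
  obtain ⟨k1, k2⟩ := K w hw
  dsimp only
  constructor
  · rw [h1, k1]
    push_cast
    rw [add_mul, Complex.exp_add]
    ring
  · have : (1 + h w) * (1 + k w) - 1 = h w + k w + h w * k w := by ring
    rw [this, Real.exp_add]
    have h3 := norm_add₃_le (a := h w) (b := k w) (c := h w * k w)
    rw [norm_mul] at h3
    have := mul_le_mul h2 k2 (norm_nonneg _) ((norm_nonneg _).trans h2)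
    nlinarith

lemma NearMonomial.prod {ι : Type*} (S : Finset ι) {s : ι → ℝ} {F : ι → ℂ → ℂ}
    (hF : ∀ i ∈ S, NearMonomial (s i) (F i)) :
    NearMonomial (∑ i ∈ S, s i) (fun w => ∏ i ∈ S, F i w) := by
  classical
  induction S using Finset.induction_on with
  | empty => simpa using NearMonomial.monomial one_ne_zero 0
  | insert i S hi ih =>
    simp only [Finset.sum_insert hi, Finset.prod_insert hi]
    exact (hF i (by simp)).mul (ih fun j hj => hF j (by simp [hj]))

lemma prod_exp_sub (n : ℕ) (hn : 0 < n) (w α : ℂ) :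
    ∏ j : Fin n, (α - Complex.exp (w + 2 * Real.pi * Complex.I * ((j : ℕ) : ℂ) / n)) =
      α ^ n - Complex.exp w ^ n := by
  have hζ := Complex.isPrimitiveRoot_exp n hn.ne'
  set ζ := Complex.exp (2 * Real.pi * Complex.I / n) with hζdef
  have : NeZero n := ⟨hn.ne'⟩
  have himg : Polynomial.nthRootsFinset n (1 : ℂ) = (Finset.range n).image (ζ ^ ·) := by
    symm
    apply Finset.eq_of_subset_of_card_le
    · intro x hx
      obtain ⟨j, -, rfl⟩ := Finset.mem_image.mp hx
      rw [Polynomial.mem_nthRootsFinset hn, ← pow_mul, mul_comm, pow_mul, hζ.pow_eq_one, one_pow]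
    · rw [hζ.card_nthRootsFinset, Finset.card_image_of_injOn, Finset.card_range]
      intro a ha b hb hab
      exact hζ.pow_inj (Finset.mem_range.mp ha) (Finset.mem_range.mp hb) hab
  rw [hζ.pow_sub_pow_eq_prod_sub_mul _ _ hn, himg, Finset.prod_image, Finset.prod_range]
  · refine Finset.prod_congr rfl fun j _ => ?_
    rw [hζdef, ← Complex.exp_nat_mul, ← Complex.exp_add]
    congr 2
    ring
  · intro a ha b hb hab
    exact hζ.pow_inj (Finset.mem_range.mp ha) (Finset.mem_range.mp hb) hab

/-- The product is `α^n - e^{nw}`; the main term is whichever summand is larger on the circle. A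
root at `0` leaves an exact monomial, so it needs no gap condition. -/
lemma nearMonomial_root {n : ℕ} (hn : 0 < n) {δ : ℝ} {α : ℂ} (hα : α ≠ 0 → δ ≤ |Real.log ‖α‖|) :
    NearMonomial (Real.exp (-(n * δ))) (fun w => ∏ j : Fin n,
      (α - Complex.exp (w + 2 * Real.pi * Complex.I * ((j : ℕ) : ℂ) / n))) := by
  simp only [prod_exp_sub n hn]
  have hle : Real.exp (-(n * δ)) ≤ Real.exp (Real.exp (-(n * δ))) - 1 := by
    have := Real.add_one_le_exp (Real.exp (-(n * δ)))
    linarith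
  have hw1 : ∀ w : ℂ, w.re = 0 → ‖Complex.exp w‖ = 1 := fun w hw => by
    rw [Complex.norm_exp, hw, Real.exp_zero]
  by_cases hbig : α ≠ 0 ∧ 0 ≤ Real.log ‖α‖
  · obtain ⟨h0, h1⟩ := hbig
    have h2 := hα h0
    rw [abs_of_nonneg h1] at h2
    refine ⟨α ^ n, pow_ne_zero _ h0, 0, fun w => -(Complex.exp w ^ n / α ^ n), fun w hw => ⟨?_, ?_⟩⟩
    · simp only [Int.cast_zero, zero_mul, Complex.exp_zero, mul_one]
      field_simp
      ring
    · refine le_trans ?_ hle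
      rw [norm_neg, norm_div, norm_pow, norm_pow, hw1 w hw, one_pow, one_div,
        ← Real.exp_log (norm_pos_iff.mpr h0), ← Real.exp_nat_mul, ← Real.exp_neg]
      gcongr
  · refine ⟨-1, by simp, n, fun w => -(α ^ n / Complex.exp w ^ n), fun w hw => ⟨?_, ?_⟩⟩
    · have := Complex.exp_ne_zero w
      rw [Int.cast_natCast, Complex.exp_nat_mul]
      field_simp
      ring
    · refine le_trans ?_ hle
      rw [norm_neg, norm_div, norm_pow, norm_pow, hw1 w hw, one_pow, div_one]
      by_cases h0 : α = 0
      · simp [h0, hn.ne', Real.exp_nonneg]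
      · have h1 : Real.log ‖α‖ < 0 := by
          by_contra h
          exact hbig ⟨h0, not_lt.mp h⟩
        have h2 := hα h0
        rw [abs_of_neg h1] at h2
        rw [← Real.exp_log (norm_pos_iff.mpr h0), ← Real.exp_nat_mul]
        gcongr
        have hn' : (0 : ℝ) < n := by exact_mod_cast hn
        nlinarith

lemma nearMonomial_roots {n : ℕ} (hn : 0 < n) {δ : ℝ} (R : Multiset ℂ)
    (hR : ∀ α ∈ R, α ≠ 0 → δ ≤ |Real.log ‖α‖|) :
    NearMonomial (R.card * Real.exp (-(n * δ))) (fun w => ∏ j : Fin n,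
      (R.map fun α =>
        Complex.exp (w + 2 * Real.pi * Complex.I * ((j : ℕ) : ℂ) / n) - α).prod) := by
  induction R using Multiset.induction_on with
  | empty => simpa using NearMonomial.monomial one_ne_zero 0
  | cons α R ih =>
    have h := ((NearMonomial.monomial (C := (-1) ^ n) (by simp) 0).mul
      (nearMonomial_root hn (hR α (by simp)))).mul (ih fun β hβ => hR β (by simp [hβ]))
    convert h using 1
    · simp; ring
    · ext w
      simp only [Multiset.map_cons, Multiset.prod_cons, Finset.prod_mul_distrib]
      congr 1
      simp only [Int.cast_zero, zero_mul, Complex.exp_zero, mul_one]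
      rw [← Fintype.card_fin n, ← Finset.card_univ, ← Finset.prod_const, Finset.card_univ,
        Fintype.card_fin, ← Finset.prod_mul_distrib]
      exact Finset.prod_congr rfl fun j _ => by ring

lemma sum_mul_add_single (ξ : Fin r → ℂ) (k : Fin r → ℤ) (i : Fin r) (w : ℂ) :
    ∑ j, (k j : ℂ) * (ξ + Pi.single i w : Fin r → ℂ) j = ∑ j, (k j : ℂ) * ξ j + k i * w := by
  simp only [Pi.add_apply, mul_add, Finset.sum_add_distrib]
  congr 1
  rw [Finset.sum_eq_single i] <;> simp +contextual

/-- Removing the lowest power of `e^w` leaves a polynomial `p` of degree at most `c`. For special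
`ξ` its constant term may cancel, whence possible roots at `0`; the nonzero roots avoid the annulus
where `f` does not vanish. -/
lemma nearMonomial_direction {n : ℕ} (hn : 0 < n) (f : LaurentPoly r) (i : Fin r) {c : ℝ}
    (hc : ∀ k ∈ f.coeff.support, ∀ l ∈ f.coeff.support, ((k i - l i : ℤ) : ℝ) ≤ c)
    {δ : ℝ} (hδ : 0 < δ) (ξ : Fin r → ℂ)
    (hnv : ∀ w : ℂ, |w.re| < δ → expEval (ξ + Pi.single i w) f ≠ 0) :
    NearMonomial (c * Real.exp (-(n * δ))) (fun w => ∏ j : Fin n,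
      expEval (ξ + Pi.single i (w + 2 * Real.pi * Complex.I * ((j : ℕ) : ℂ) / n)) f) := by
  have hS : f.coeff.support.Nonempty := by
    by_contra h
    rw [Finset.not_nonempty_iff_eq_empty] at h
    exact hnv 0 (by simpa using hδ) (by simp [expEval_eq_sum, h])
  obtain ⟨l, hl, hlmin⟩ := f.coeff.support.exists_min_image (fun k => k i) hS
  obtain ⟨u, hu, humax⟩ := f.coeff.support.exists_max_image (fun k => k i) hS
  set p : Polynomial ℂ := ∑ k ∈ f.coeff.support, Polynomial.monomial (k i - l i).toNat
    (f.coeff k * Complex.exp (∑ j, (k j : ℂ) * ξ j)) with hp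
  have hpe : ∀ w : ℂ, expEval (ξ + Pi.single i w) f =
      Complex.exp (l i * w) * p.eval (Complex.exp w) := by
    intro w
    rw [expEval_eq_sum, hp, Polynomial.eval_finsetSum, Finset.mul_sum]
    refine Finset.sum_congr rfl fun k hk => ?_
    have h1 : (((k i - l i).toNat : ℕ) : ℂ) = k i - l i := by
      have := Int.toNat_of_nonneg (sub_nonneg.mpr (hlmin k hk))
      exact_mod_cast congrArg (Int.cast : ℤ → ℂ) this
    rw [Polynomial.eval_monomial, sum_mul_add_single, ← Complex.exp_nat_mul, h1, Complex.exp_add,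
      sub_mul, Complex.exp_sub]
    have := Complex.exp_ne_zero (l i * w)
    field_simp
  have hdeg : (p.natDegree : ℝ) ≤ c := by
    have h1 : p.natDegree ≤ (u i - l i).toNat :=
      Polynomial.natDegree_sum_le_of_forall_le _ _ fun k hk =>
        (Polynomial.natDegree_monomial_le _).trans
          (Int.toNat_le_toNat (sub_le_sub_right (humax k hk) _))
    have h2 : (((u i - l i).toNat : ℤ) : ℝ) ≤ c := by
      rw [Int.toNat_of_nonneg (sub_nonneg.mpr (hlmin u hu))]
      exact hc u hu l hl
    refine le_trans ?_ h2
    exact_mod_cast h1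
  have hp0 : p ≠ 0 := by
    rintro h
    exact hnv 0 (by simpa using hδ) (by rw [hpe, h]; simp)
  have hroots : ∀ α ∈ p.roots, α ≠ 0 → δ ≤ |Real.log ‖α‖| := by
    intro α hα h0
    by_contra h
    refine hnv (Complex.log α) (by rw [Complex.log_re]; exact not_le.mp h) ?_
    rw [hpe, Complex.exp_log h0, (Polynomial.isRoot_of_mem_roots hα).eq_zero, mul_zero]
  have hsplit : ∀ z, p.eval z = p.leadingCoeff * (p.roots.map fun α => z - α).prod := fun z =>
    (IsAlgClosed.splits p).eval_eq_prod_roots z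
  have hD : ∏ j : Fin n, Complex.exp (l i * (2 * Real.pi * Complex.I * ((j : ℕ) : ℂ) / n)) ≠ 0 :=
    Finset.prod_ne_zero_iff.mpr fun j _ => Complex.exp_ne_zero _
  have h := (NearMonomial.monomial (mul_ne_zero hD (pow_ne_zero n
    (Polynomial.leadingCoeff_ne_zero.mpr hp0))) (n * l i)).mul (nearMonomial_roots hn p.roots hroots)
  have hle : 0 + p.roots.card * Real.exp (-(n * δ)) ≤ c * Real.exp (-(n * δ)) := by
    rw [zero_add]
    gcongr
    exact le_trans (by exact_mod_cast p.card_roots') hdeg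
  convert h.mono hle using 2 with w
  simp only [hpe, hsplit, mul_add, Complex.exp_add, Finset.prod_mul_distrib]
  simp only [Finset.prod_const, Finset.card_univ, Fintype.card_fin, ← Complex.exp_nat_mul]
  push_cast
  simp only [mul_assoc]
  ring

lemma nearMonomial_cyclicResultant {n : ℕ} (hn : 0 < n) (f : LaurentPoly r) (i : Fin r) {c : ℝ}
    (hc : ∀ k ∈ f.coeff.support, ∀ l ∈ f.coeff.support, ((k i - l i : ℤ) : ℝ) ≤ c)
    {δ : ℝ} (hδ : 0 < δ) (ξ : Fin r → ℂ)
    (hnv : ∀ ξ' : Fin r → ℂ, (∀ j, (ξ' j).re = (ξ j).re) →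
      ∀ w : ℂ, |w.re| < δ → expEval (ξ' + Pi.single i w) f ≠ 0) :
    NearMonomial (n ^ (r - 1) * (c * Real.exp (-(n * δ))))
      (fun w => expEval (ξ + Pi.single i w) (cyclicResultant f n)) := by
  let ξ' : ({j // j ≠ i} → Fin n) → Fin r → ℂ := fun u l =>
    ξ l + if h : l ≠ i then 2 * Real.pi * Complex.I * ((u ⟨l, h⟩ : ℕ) : ℂ) / n else 0
  have h := NearMonomial.prod Finset.univ fun u (_ : u ∈ Finset.univ) =>
    nearMonomial_direction hn f i hc hδ (ξ' u) (hnv (ξ' u) fun j => by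
      by_cases h : j = i
      · simp [ξ', h]
      · have : (2 * Real.pi * Complex.I * ((u ⟨j, h⟩ : ℕ) : ℂ) / n : ℂ).re = 0 := by
          have : (2 * Real.pi * Complex.I * ((u ⟨j, h⟩ : ℕ) : ℂ) / n : ℂ) =
              ((2 * Real.pi * (u ⟨j, h⟩ : ℕ) / n : ℝ) : ℂ) * Complex.I := by
            push_cast; ring
          rw [this, Complex.re_ofReal_mul, Complex.I_re, mul_zero]
        simp [ξ', h, this])
  convert h using 1
  · simp
  · ext w
    -- The `i`-th rotation is absorbed into `w`, the other `r - 1` rotations into the base points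
    -- `ξ'`.
    rw [expEval_cyclicResultant, ← (Equiv.funSplitAt i (Fin n)).symm.prod_comp,
      Fintype.prod_prod_type_right]
    refine Finset.prod_congr rfl fun u _ => Finset.prod_congr rfl fun j _ => ?_
    congr 2
    ext l
    by_cases h : l = i
    · subst h
      simp [ξ', rootAngle, Equiv.funSplitAt, Equiv.piSplitAt]
      ring
    · simp [ξ', rootAngle, Equiv.funSplitAt, Equiv.piSplitAt, h]

/-! ### Parseval's identity on a finite grid of the torus. -/

/-- Parseval's identity for finitely many orthogonal unimodular functions on a finite set. -/
lemma sum_norm_sq_eq_of_orthogonal {ι T : Type*} [Fintype T] (S : Finset ι) (χ : ι → T → ℂ)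
    (hnorm : ∀ k ∈ S, ∀ t, ‖χ k t‖ = 1)
    (horth : ∀ k ∈ S, ∀ l ∈ S, k ≠ l → ∑ t, χ k t * (starRingEnd ℂ) (χ l t) = 0) (B : ι → ℂ) :
    ∑ t, ‖∑ k ∈ S, B k * χ k t‖ ^ 2 = Fintype.card T * ∑ k ∈ S, ‖B k‖ ^ 2 := by
  classical
  have h : ((∑ t, ‖∑ k ∈ S, B k * χ k t‖ ^ 2 : ℝ) : ℂ) =
      ((Fintype.card T * ∑ k ∈ S, ‖B k‖ ^ 2 : ℝ) : ℂ) := by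
    push_cast
    simp only [← Complex.mul_conj', map_sum, map_mul, Finset.sum_mul_sum]
    rw [Finset.sum_comm, Finset.mul_sum]
    refine Finset.sum_congr rfl fun k hk => ?_
    rw [Finset.sum_comm, Finset.sum_eq_single_of_mem k hk]
    · have : ∀ t, B k * χ k t * ((starRingEnd ℂ) (B k) * (starRingEnd ℂ) (χ k t)) =
          B k * (starRingEnd ℂ) (B k) := fun t => by
        have h1 : χ k t * (starRingEnd ℂ) (χ k t) = 1 := by
          rw [Complex.mul_conj', hnorm k hk t]; simp
        linear_combination B k * (starRingEnd ℂ) (B k) * h1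
      simp [this]
    · intro l hl hlk
      have : ∀ t, B k * χ k t * ((starRingEnd ℂ) (B l) * (starRingEnd ℂ) (χ l t)) =
          B k * (starRingEnd ℂ) (B l) * (χ k t * (starRingEnd ℂ) (χ l t)) := fun t => by ring
      simp only [this, ← Finset.mul_sum, horth k hk l hl hlk.symm, mul_zero]
  exact_mod_cast h

lemma sum_exp_eq_zero {N : ℕ} (hN : 0 < N) {m : ℤ} (hm : ¬ (N : ℤ) ∣ m) :
    ∑ t : Fin N, Complex.exp (m * (2 * Real.pi * Complex.I * ((t : ℕ) : ℂ) / N)) = 0 := by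
  have hN' : (N : ℂ) ≠ 0 := by exact_mod_cast hN.ne'
  set x := Complex.exp (m * (2 * Real.pi * Complex.I / N)) with hx
  have h1 : x ≠ 1 := by
    rw [hx, Ne, Complex.exp_eq_one_iff]
    rintro ⟨q, hq⟩
    refine hm ⟨q, ?_⟩
    have := Complex.two_pi_I_ne_zero
    have h3 : (m : ℂ) = N * q := by
      field_simp at hq
      linear_combination hq
    exact_mod_cast h3
  have h2 : x ^ N = 1 := by
    rw [hx, ← Complex.exp_nat_mul, Complex.exp_eq_one_iff]
    exact ⟨m, by field_simp⟩
  have h3 : ∑ t : Fin N, Complex.exp (m * (2 * Real.pi * Complex.I * ((t : ℕ) : ℂ) / N)) =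
      ∑ t ∈ Finset.range N, x ^ t := by
    rw [Finset.sum_range]
    refine Finset.sum_congr rfl fun t _ => ?_
    rw [hx, ← Complex.exp_nat_mul]
    congr 1
    ring
  rw [h3, geom_sum_eq h1, h2, sub_self, zero_div]

lemma sum_exp_rootAngle_eq_zero {N : ℕ} (hN : 0 < N) {m : Fin r → ℤ} {j : Fin r}
    (hm : ¬ (N : ℤ) ∣ m j) :
    ∑ t : Fin r → Fin N, Complex.exp (∑ j, (m j : ℂ) * rootAngle N t j) = 0 := by
  simp only [Complex.exp_sum, rootAngle]
  have := Fintype.prod_sum fun (j : Fin r) (t : Fin N) =>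
    Complex.exp (m j * (2 * Real.pi * Complex.I * ((t : ℕ) : ℂ) / N))
  rw [← this]
  exact Finset.prod_eq_zero (Finset.mem_univ j) (sum_exp_eq_zero hN hm)

lemma conj_exp_sum_rootAngle {N : ℕ} (l : Fin r → ℤ) (t : Fin r → Fin N) :
    (starRingEnd ℂ) (Complex.exp (∑ j, (l j : ℂ) * rootAngle N t j)) =
      Complex.exp (∑ j, ((-l j : ℤ) : ℂ) * rootAngle N t j) := by
  rw [← Complex.exp_conj, map_sum]
  congr 1
  refine Finset.sum_congr rfl fun j _ => ?_
  simp [rootAngle, map_ofNat]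
  ring

lemma norm_exp_sum_rootAngle {N : ℕ} (l : Fin r → ℤ) (t : Fin r → Fin N) :
    ‖Complex.exp (∑ j, (l j : ℂ) * rootAngle N t j)‖ = 1 := by
  have : ∑ j, (l j : ℂ) * rootAngle N t j =
      ((∑ j, (l j : ℝ) * (2 * Real.pi * (t j : ℕ) / N) : ℝ) : ℂ) * Complex.I := by
    push_cast
    rw [Finset.sum_mul]
    exact Finset.sum_congr rfl fun j _ => by simp only [rootAngle]; ring
  rw [this, Complex.norm_exp_ofReal_mul_I]

/-- An order `N` for which the exponents in `S` are distinct modulo `N`. -/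
lemma exists_separating_order (S : Finset (Fin r → ℤ)) :
    ∃ N : ℕ, 0 < N ∧ ∀ k ∈ S, ∀ l ∈ S, k ≠ l → ∃ j, ¬ (N : ℤ) ∣ k j - l j := by
  -- Coordinates of differences are at most twice the total sum in absolute value, so a multiple of
  -- this `N` among them is zero.
  refine ⟨2 * (∑ k ∈ S, ∑ j, (k j).natAbs) + 1, by omega, fun k hk l hl hkl => ?_⟩
  obtain ⟨j, hj⟩ := Function.ne_iff.mp hkl
  refine ⟨j, fun hdvd => hj ?_⟩
  have hb : ∀ m ∈ S, (m j).natAbs ≤ ∑ k ∈ S, ∑ j, (k j).natAbs := fun m hm =>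
    (Finset.single_le_sum (f := fun j => (m j).natAbs) (fun _ _ => Nat.zero_le _)
      (Finset.mem_univ j)).trans
    (Finset.single_le_sum (f := fun m : Fin r → ℤ => ∑ j, (m j).natAbs)
      (fun _ _ => Nat.zero_le _) hm)
  have h1 := hb k hk
  have h2 := hb l hl
  have h3 := Int.eq_zero_of_abs_lt_dvd hdvd (by rw [Int.abs_eq_natAbs]; omega)
  omega

lemma sum_norm_sq_rootAngle {N : ℕ} (hN : 0 < N) (S : Finset (Fin r → ℤ))
    (hS : ∀ k ∈ S, ∀ l ∈ S, k ≠ l → ∃ j, ¬ (N : ℤ) ∣ k j - l j) (B : (Fin r → ℤ) → ℂ) :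
    ∑ t : Fin r → Fin N, ‖∑ k ∈ S, B k * Complex.exp (∑ j, (k j : ℂ) * rootAngle N t j)‖ ^ 2 =
      (N : ℝ) ^ r * ∑ k ∈ S, ‖B k‖ ^ 2 := by
  rw [sum_norm_sq_eq_of_orthogonal S
    (fun k (t : Fin r → Fin N) => Complex.exp (∑ j, (k j : ℂ) * rootAngle N t j))]
  · simp
  · exact fun k _ t => norm_exp_sum_rootAngle k t
  · intro k hk l hl hkl
    obtain ⟨j, hj⟩ := hS k hk l hl hkl
    simp only [conj_exp_sum_rootAngle, ← Complex.exp_add, ← Finset.sum_add_distrib, ← add_mul]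
    have := sum_exp_rootAngle_eq_zero (r := r) hN (m := k - l) (j := j) hj
    simpa [sub_eq_add_neg] using this

/-! ### The dominant exponent in one coordinate direction. -/

/-- The trigonometric sum of a list of coefficients close to a monomial is dominated by one of
its coefficients. -/
lemma NearMonomial.exists_dominant {s : ℝ} (hs : s ≤ 1 / 4) (E : Finset ℤ) (G : ℤ → ℂ)
    (h : NearMonomial s fun w => ∑ l ∈ E, G l * Complex.exp (l * w)) :
    ∃ M ∈ E, G M ≠ 0 ∧ ∑ l ∈ E.erase M, ‖G l‖ ^ 2 ≤ (2 * s) ^ 2 * ‖G M‖ ^ 2 := by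
  obtain ⟨C, hC, M, e, H⟩ := h
  have hη0 : 0 ≤ Real.exp s - 1 := (norm_nonneg _).trans (H 0 rfl).2
  set η := Real.exp s - 1 with hη
  have hs0 : 0 ≤ s := by
    rw [sub_nonneg, Real.one_le_exp_iff] at hη0
    exact hη0
  -- From `e^s (1 - s) ≤ 1` comes `η ≤ s / (1 - s)`; the factor `2` then uses `s ≤ 1/4`.
  have hηs : η ≤ 2 * s * (1 - η) := by
    have h1 : Real.exp s * (1 - s) ≤ 1 := by
      have := Real.add_one_le_exp (-s)
      calc Real.exp s * (1 - s) ≤ Real.exp s * Real.exp (-s) := by gcongr; linarith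
        _ = 1 := by rw [← Real.exp_add]; simp
    have h2 : η * (1 - s) ≤ s := by rw [hη]; linarith
    nlinarith
  -- Coefficients of the sum minus its approximating monomial. `M` is not yet known to lie in `E`,
  -- hence the index set `insert M E`.
  set B : ℤ → ℂ := fun l => (if l ∈ E then G l else 0) - (if l = M then C else 0) with hB
  have hsum : ∀ w : ℂ, w.re = 0 → ‖∑ l ∈ insert M E, B l * Complex.exp (l * w)‖ ≤ η * ‖C‖ := by
    intro w hw
    have h1 : ∑ l ∈ insert M E, B l * Complex.exp (l * w) = C * Complex.exp (M * w) * e w := by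
      simp only [hB, sub_mul, Finset.sum_sub_distrib, ite_mul, zero_mul]
      rw [Finset.sum_ite_mem, Finset.sum_ite_eq',
        Finset.inter_eq_right.mpr (Finset.subset_insert M E), if_pos (Finset.mem_insert_self M E),
        show ∑ l ∈ E, G l * Complex.exp (l * w) = _ from (H w hw).1]
      ring
    have h2 : ‖Complex.exp (M * w)‖ = 1 := by
      rw [Complex.norm_exp]
      simp [hw]
    rw [h1, norm_mul, norm_mul, h2, mul_one, mul_comm]
    exact mul_le_mul_of_nonneg_right (H w hw).2 (norm_nonneg _)
  have hP : ∑ l ∈ insert M E, ‖B l‖ ^ 2 ≤ (η * ‖C‖) ^ 2 := by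
    let S : Finset (Fin 1 → ℤ) := (insert M E).image fun l _ => l
    have hinj : Set.InjOn (fun (l : ℤ) (_ : Fin 1) => l) (insert M E : Finset ℤ) :=
      fun a _ b _ hab => congrFun hab 0
    obtain ⟨N, hN, hsep⟩ := exists_separating_order S
    have hpars := sum_norm_sq_rootAngle hN S hsep fun k => B (k 0)
    have hN' : (0 : ℝ) < N := by exact_mod_cast hN
    have hle : ∑ t : Fin 1 → Fin N,
        ‖∑ k ∈ S, B (k 0) * Complex.exp (∑ j, (k j : ℂ) * rootAngle N t j)‖ ^ 2 ≤
        (N : ℝ) ^ 1 * (η * ‖C‖) ^ 2 := by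
      calc _ ≤ ∑ t : Fin 1 → Fin N, (η * ‖C‖) ^ 2 := by
            refine Finset.sum_le_sum fun t _ => ?_
            gcongr
            rw [Finset.sum_image hinj]
            simp only [Finset.univ_unique, Fin.default_eq_zero, Finset.sum_singleton]
            refine hsum _ ?_
            have : rootAngle N t 0 = ((2 * Real.pi * (t 0 : ℕ) / N : ℝ) : ℂ) * Complex.I := by
              simp only [rootAngle]; push_cast; ring
            rw [this, Complex.re_ofReal_mul, Complex.I_re, mul_zero]
        _ = _ := by simp
    rw [hpars, Finset.sum_image hinj] at hle
    exact le_of_mul_le_mul_left hle (by positivity)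
  have hCpos : 0 < ‖C‖ := norm_pos_iff.mpr hC
  have hη1 : η ≤ 1 / 3 := by nlinarith
  rw [← Finset.add_sum_erase _ _ (Finset.mem_insert_self M E), Finset.erase_insert_eq_erase] at hP
  have hrest : ∑ l ∈ E.erase M, ‖B l‖ ^ 2 = ∑ l ∈ E.erase M, ‖G l‖ ^ 2 := by
    refine Finset.sum_congr rfl fun l hl => ?_
    obtain ⟨h1, h2⟩ := Finset.mem_erase.mp hl
    simp [hB, h1, h2]
  rw [hrest] at hP
  have hnn : 0 ≤ ∑ l ∈ E.erase M, ‖G l‖ ^ 2 := Finset.sum_nonneg fun _ _ => by positivity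
  have hBM : ‖B M‖ ≤ η * ‖C‖ :=
    le_of_sq_le_sq (by linarith) (by positivity)
  have hME : M ∈ E := by
    by_contra h
    have : ‖B M‖ = ‖C‖ := by simp [hB, h]
    nlinarith
  have hGM : (1 - η) * ‖C‖ ≤ ‖G M‖ := by
    have h1 : B M = G M - C := by simp [hB, hME]
    rw [h1] at hBM
    have := norm_sub_norm_le C (G M)
    rw [norm_sub_rev] at this
    linarith
  refine ⟨M, hME, fun h => ?_, ?_⟩
  · rw [h, norm_zero] at hGM
    nlinarith
  · have h1 : η * ‖C‖ ≤ 2 * s * ‖G M‖ := by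
      calc η * ‖C‖ ≤ 2 * s * (1 - η) * ‖C‖ := by gcongr
        _ = 2 * s * ((1 - η) * ‖C‖) := by ring
        _ ≤ _ := by gcongr
    have h2 : (η * ‖C‖) ^ 2 ≤ (2 * s * ‖G M‖) ^ 2 := by gcongr
    nlinarith [sq_nonneg ‖B M‖]

/-- On a connected space, the index of the dominant function of a finite family does not vary. -/
lemma exists_uniform_dominant {X : Type*} [TopologicalSpace X] [PreconnectedSpace X] [Nonempty X]
    {ι : Type*} (E : Finset ι) (G : ι → X → ℝ) (hG : ∀ l, Continuous (G l))
    (P : ι → X → Prop) (hP : ∀ x, ∃ M ∈ E, P M x)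
    (hdom : ∀ x M, P M x → ∀ l ∈ E, l ≠ M → G l x < G M x) : ∃ M ∈ E, ∀ x, P M x := by
  choose M hME hM using hP
  -- Strict domination over finitely many continuous competitors is an open condition.
  have hloc : IsLocallyConstant M := by
    rw [IsLocallyConstant.iff_eventually_eq]
    intro x
    have h1 : ∀ᶠ y in nhds x, ∀ l ∈ E, l ≠ M x → G l y < G (M x) y := by
      rw [Filter.eventually_all_finset]
      intro l hl
      by_cases hlx : l = M x
      · simp [hlx]
      · filter_upwards [(hG l).continuousAt.eventually_lt (hG (M x)).continuousAt
          (hdom x _ (hM x) l hl hlx)] with y hy _ using hy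
    filter_upwards [h1] with y hy
    by_contra hne
    exact lt_asymm (hy _ (hME y) hne) (hdom y _ (hM y) _ (hME x) (Ne.symm hne))
  obtain ⟨x₀⟩ := ‹Nonempty X›
  refine ⟨M x₀, hME x₀, fun x => ?_⟩
  rw [← hloc.apply_eq_of_preconnectedSpace x x₀]
  exact hM x

/-! ### Term sizes, slices along a coordinate, and uniformity over a ball. -/

/-- The vector of real parts, as a point of Euclidean space. -/
def reVec : (Fin r → ℂ) →ₗ[ℝ] EuclideanSpace ℝ (Fin r) where
  toFun ξ := WithLp.toLp 2 fun j => (ξ j).re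
  map_add' ξ η := by ext j; simp
  map_smul' t ξ := by ext j; simp

@[simp] lemma reVec_apply (ξ : Fin r → ℂ) (j : Fin r) : reVec ξ j = (ξ j).re := rfl

lemma expEval_ne_zero {f : LaurentPoly r} {ε : ℝ} {a : EuclideanSpace ℝ (Fin r)}
    (hdist : ENNReal.ofReal ε ≤ Metric.infEDist a (amoeba f)) {ξ : Fin r → ℂ}
    (hξ : dist (reVec ξ) a < ε) : expEval ξ f ≠ 0 := by
  intro h0
  have hmem : reVec ξ ∈ amoeba f := by
    refine ⟨fun i => Complex.exp (ξ i), ⟨fun i => Complex.exp_ne_zero _, ?_⟩, ?_⟩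
    · rw [eval_exp, h0]
    · ext j
      simp [logMap, Complex.norm_exp]
  have h1 := hdist.trans (Metric.infEDist_le_edist_of_mem hmem)
  rw [edist_dist, ENNReal.ofReal_le_ofReal_iff dist_nonneg, dist_comm] at h1
  linarith

/-- The absolute value of the monomial of `g` with exponent `k` at the points over `v`. -/
def termSize (g : LaurentPoly r) (v : EuclideanSpace ℝ (Fin r)) (k : Fin r → ℤ) : ℝ :=
  ‖g.coeff k‖ * Real.exp (∑ j, (k j : ℝ) * v j)

lemma termSize_nonneg (g : LaurentPoly r) (v : EuclideanSpace ℝ (Fin r)) (k : Fin r → ℤ) :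
    0 ≤ termSize g v k := by unfold termSize; positivity

lemma termSize_pos {g : LaurentPoly r} (v : EuclideanSpace ℝ (Fin r)) {k : Fin r → ℤ}
    (hk : k ∈ g.coeff.support) : 0 < termSize g v k :=
  mul_pos (norm_pos_iff.mpr (Finsupp.mem_support_iff.mp hk)) (Real.exp_pos _)

lemma norm_coeff_mul_exp (g : LaurentPoly r) (ξ : Fin r → ℂ) (k : Fin r → ℤ) :
    ‖g.coeff k * Complex.exp (∑ j, (k j : ℂ) * ξ j)‖ = termSize g (reVec ξ) k := by
  rw [norm_mul, Complex.norm_exp, Complex.re_sum, termSize]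
  simp

lemma termSizes_eq (g : LaurentPoly r) (a : EuclideanSpace ℝ (Fin r)) (k : g.coeff.support) :
    termSizes g a k = termSize g a k := by
  have h := norm_coeff_mul_exp g (fun i => (a i : ℂ)) k
  have h2 : reVec (fun i => (a i : ℂ)) = a := by ext j; simp
  rw [h2, ← evalMonomial_exp] at h
  simpa [termSizes] using h

/-- The coefficient of `exp (l w)` in `w ↦ g (exp (ξ + w eᵢ))`. -/
def sliceCoeff (g : LaurentPoly r) (i : Fin r) (ξ : Fin r → ℂ) (l : ℤ) : ℂ :=
  ∑ k ∈ g.coeff.support with k i = l, g.coeff k * Complex.exp (∑ j, (k j : ℂ) * ξ j)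

lemma continuous_sliceCoeff (g : LaurentPoly r) (i : Fin r) (l : ℤ) :
    Continuous fun ξ => sliceCoeff g i ξ l := by
  unfold sliceCoeff
  fun_prop

lemma expEval_add_single (g : LaurentPoly r) (i : Fin r) (ξ : Fin r → ℂ) (w : ℂ) :
    expEval (ξ + Pi.single i w) g =
      ∑ l ∈ g.coeff.support.image (fun k => k i), sliceCoeff g i ξ l * Complex.exp (l * w) := by
  rw [expEval_eq_sum, ← Finset.sum_fiberwise_of_maps_to
    (fun k hk => Finset.mem_image_of_mem (fun k : Fin r → ℤ => k i) hk)]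
  refine Finset.sum_congr rfl fun l _ => ?_
  rw [sliceCoeff, Finset.sum_mul]
  refine Finset.sum_congr rfl fun k hk => ?_
  rw [sum_mul_add_single, (Finset.mem_filter.mp hk).2, Complex.exp_add, mul_assoc]

/-- Averaging over the grid removes the cross terms between exponents sharing the `i`-th coordinate,
leaving the squares of the individual term sizes. -/
lemma sum_norm_sliceCoeff {N : ℕ} (hN : 0 < N) (g : LaurentPoly r)
    (hS : ∀ k ∈ g.coeff.support, ∀ l ∈ g.coeff.support, k ≠ l → ∃ j, ¬ (N : ℤ) ∣ k j - l j)
    (i : Fin r) (v : EuclideanSpace ℝ (Fin r)) (l : ℤ) :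
    ∑ t : Fin r → Fin N, ‖sliceCoeff g i ((fun j => (v j : ℂ)) + rootAngle N t) l‖ ^ 2 =
      (N : ℝ) ^ r * ∑ k ∈ g.coeff.support with k i = l, termSize g v k ^ 2 := by
  have h := sum_norm_sq_rootAngle hN (g.coeff.support.filter fun k => k i = l)
    (fun k hk l hl => hS k (Finset.mem_of_mem_filter k hk) l (Finset.mem_of_mem_filter l hl))
    (fun k => g.coeff k * Complex.exp (∑ j, (k j : ℂ) * (v j : ℂ)))
  have h2 : reVec (fun i => (v i : ℂ)) = v := by ext j; simp
  simp only [norm_coeff_mul_exp, h2] at h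
  rw [← h]
  refine Finset.sum_congr rfl fun t _ => ?_
  congr 2
  refine Finset.sum_congr rfl fun k _ => ?_
  simp only [Pi.add_apply, mul_add, Finset.sum_add_distrib, Complex.exp_add]
  ring

lemma reVec_rootAngle {N : ℕ} (t : Fin r → Fin N) : reVec (rootAngle N t) = 0 := by
  ext j
  have : rootAngle N t j = ((2 * Real.pi * (t j : ℕ) / N : ℝ) : ℂ) * Complex.I := by
    simp only [rootAngle]; push_cast; ring
  rw [reVec_apply, this, Complex.re_ofReal_mul, Complex.I_re, mul_zero]
  rfl

lemma dist_reVec_add_single_le {ξ ξ' : Fin r → ℂ} (hξ' : ∀ j, (ξ' j).re = (ξ j).re) (i : Fin r)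
    (w : ℂ) (a : EuclideanSpace ℝ (Fin r)) :
    dist (reVec (ξ' + Pi.single i w)) a ≤ |w.re| + dist (reVec ξ) a := by
  have h1 : reVec (ξ' + Pi.single i w) = reVec ξ + EuclideanSpace.single i w.re := by
    ext j
    by_cases h : j = i
    · subst h; simp [hξ']
    · simp [hξ', h]
  refine (dist_triangle _ (reVec ξ) _).trans (add_le_add_left (le_of_eq ?_) _)
  rw [h1, dist_self_add_left, PiLp.norm_single, Real.norm_eq_abs]

/-- Over the ball of radius `τ` there is still room `ε - τ` to move along axis `i`. The points above
the ball form a convex set, so the dominant exponent of the slices is constant there; grid averaging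
then gives the inequality for every `v` with the same `M`. -/
lemma exists_dominant_exponent {n : ℕ} (hn : 0 < n) (f : LaurentPoly r) {c : ℝ} (i : Fin r)
    (hc : ∀ k ∈ f.coeff.support, ∀ l ∈ f.coeff.support, ((k i - l i : ℤ) : ℝ) ≤ c)
    {ε : ℝ} {a : EuclideanSpace ℝ (Fin r)}
    (hdist : ENNReal.ofReal ε ≤ Metric.infEDist a (amoeba f))
    {τ s : ℝ} (hτ : 0 ≤ τ) (hτε : τ < ε) (hs : s ≤ 1 / 4)
    (hcs : n ^ (r - 1) * (c * Real.exp (-(n * (ε - τ)))) ≤ s) :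
    ∃ M : ℤ, ∀ v, dist v a ≤ τ →
      ∑ k ∈ (cyclicResultant f n).coeff.support with k i ≠ M,
          termSize (cyclicResultant f n) v k ^ 2 ≤
        (2 * s) ^ 2 * ∑ k ∈ (cyclicResultant f n).coeff.support with k i = M,
          termSize (cyclicResultant f n) v k ^ 2 := by
  classical
  set g := cyclicResultant f n
  set E := g.coeff.support.image (fun k => k i)
  let X : Set (Fin r → ℂ) := {ξ | dist (reVec ξ) a ≤ τ}
  have hXconv : Convex ℝ X := (convex_closedBall a τ).linear_preimage reVec
  have hXre : reVec (fun i => (a i : ℂ)) = a := by ext j; simp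
  have : Nonempty X := ⟨⟨fun i => (a i : ℂ), by simp [X, hXre, hτ]⟩⟩
  have : PreconnectedSpace X := Subtype.preconnectedSpace hXconv.isPreconnected
  have hnear : ∀ ξ ∈ X, NearMonomial s fun w =>
      ∑ l ∈ E, sliceCoeff g i ξ l * Complex.exp (l * w) := by
    intro ξ hξ
    simp only [E, ← expEval_add_single]
    refine (nearMonomial_cyclicResultant hn f i hc (sub_pos.mpr hτε) ξ ?_).mono hcs
    intro ξ' hξ' w hw
    refine expEval_ne_zero hdist ?_
    have h1 : dist (reVec ξ) a ≤ τ := hξ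
    have h2 := dist_reVec_add_single_le hξ' i w a
    linarith
  have hslice : ∀ l, Continuous fun x : X => ‖sliceCoeff g i x l‖ := by
    intro l
    exact ((continuous_sliceCoeff g i l).comp continuous_subtype_val).norm
  obtain ⟨M, hM, hdom⟩ := exists_uniform_dominant (X := X) E
    (fun l x => ‖sliceCoeff g i x l‖) hslice
    (fun M x => sliceCoeff g i x M ≠ 0 ∧ ∑ l ∈ E.erase M, ‖sliceCoeff g i x l‖ ^ 2 ≤
      (2 * s) ^ 2 * ‖sliceCoeff g i x M‖ ^ 2)
    (fun x => (hnear x x.2).exists_dominant hs)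
    (by
      rintro x M ⟨h0, h1⟩ l hl hlM
      have h2 := (Finset.single_le_sum (f := fun l => ‖sliceCoeff g i x l‖ ^ 2)
        (fun _ _ => by positivity) (Finset.mem_erase.mpr ⟨hlM, hl⟩)).trans h1
      have h3 : 0 < ‖sliceCoeff g i x M‖ := norm_pos_iff.mpr h0
      have hs0 : 0 ≤ s := by
        obtain ⟨C, -, _, e, H⟩ := hnear x x.2
        have := (norm_nonneg _).trans (H 0 rfl).2
        rwa [sub_nonneg, Real.one_le_exp_iff] at this
      refine lt_of_pow_lt_pow_left₀ 2 h3.le (h2.trans_lt ?_)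
      have h4 : (2 * s) ^ 2 < 1 := by nlinarith
      have h5 : 0 < ‖sliceCoeff g i x M‖ ^ 2 := by positivity
      nlinarith)
  refine ⟨M, fun v hv => ?_⟩
  obtain ⟨N, hN, hsep⟩ := exists_separating_order g.coeff.support
  have hN' : (0 : ℝ) < N ^ r := by positivity
  refine le_of_mul_le_mul_left ?_ hN'
  have hmem : ∀ t : Fin r → Fin N, (fun j => (v j : ℂ)) + rootAngle N t ∈ X := by
    intro t
    have h2 : reVec (fun i => (v i : ℂ)) = v := by ext j; simp
    change dist (reVec _) a ≤ τ
    rw [map_add, reVec_rootAngle, add_zero, h2]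
    exact hv
  have hfib : ∑ k ∈ g.coeff.support with k i ≠ M, termSize g v k ^ 2 =
      ∑ l ∈ E.erase M, ∑ k ∈ g.coeff.support with k i = l, termSize g v k ^ 2 := by
    rw [← Finset.sum_fiberwise_of_maps_to (s := g.coeff.support.filter fun k => k i ≠ M)
      (t := E.erase M) (g := fun k => k i)]
    · refine Finset.sum_congr rfl fun l hl => ?_
      congr 1
      ext k
      simp only [Finset.mem_filter]
      have := Finset.ne_of_mem_erase hl
      constructor
      · rintro ⟨⟨h1, -⟩, h2⟩; exact ⟨h1, h2⟩
      · rintro ⟨h1, h2⟩; exact ⟨⟨h1, h2 ▸ this⟩, h2⟩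
    · intro k hk
      obtain ⟨h1, h2⟩ := Finset.mem_filter.mp hk
      exact Finset.mem_erase.mpr ⟨h2, Finset.mem_image_of_mem _ h1⟩
  rw [hfib, Finset.mul_sum, mul_left_comm]
  simp only [← sum_norm_sliceCoeff hN g hsep]
  rw [Finset.sum_comm, Finset.mul_sum]
  exact Finset.sum_le_sum fun t _ => (hdom ⟨_, hmem t⟩).2

lemma termSize_eq_zero {g : LaurentPoly r} (v : EuclideanSpace ℝ (Fin r)) {k : Fin r → ℤ}
    (hk : k ∉ g.coeff.support) : termSize g v k = 0 := by
  rw [termSize, Finsupp.notMem_support_iff.mp hk, norm_zero, zero_mul]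

lemma termSize_add_single (g : LaurentPoly r) (a : EuclideanSpace ℝ (Fin r)) (j : Fin r) (t : ℝ)
    (k : Fin r → ℤ) :
    termSize g (a + EuclideanSpace.single j t) k = termSize g a k * Real.exp (k j * t) := by
  have h : ∑ i, (k i : ℝ) * (a + EuclideanSpace.single j t) i = ∑ i, (k i : ℝ) * a i + k j * t := by
    simp only [PiLp.add_apply, mul_add, Finset.sum_add_distrib]
    congr 1
    rw [Finset.sum_eq_single j] <;> simp +contextual
  rw [termSize, termSize, h, Real.exp_add, mul_assoc]

/-! ### From concentration in each direction to a single dominant term. -/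

/-- If `β` nearly concentrates on `k i = M i` for each `i`, then `β M` dominates strongly. -/
lemma mul_lt_of_concentrated {S : Finset (Fin r → ℤ)} (hS : S.Nonempty) {β : (Fin r → ℤ) → ℝ}
    (hβ : ∀ k ∈ S, 0 < β k) {D s : ℝ} (hD : (S.card : ℝ) ≤ D) (hs0 : 0 ≤ s) (hs : s ≤ 3 / (16 * D))
    {M : Fin r → ℤ} (hM : ∀ i, ∑ k ∈ S with k i ≠ M i, β k ^ 2 ≤
      (2 * s) ^ 2 * ∑ k ∈ S with k i = M i, β k ^ 2) :
    M ∈ S ∧ ∀ k ∈ S, k ≠ M → D * β k < β M := by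
  classical
  have hD1 : 1 ≤ D := le_trans (by exact_mod_cast hS.card_pos) hD
  rcases (S.erase M).eq_empty_or_nonempty with he | hne
  · have hSM : S = {M} := by
      refine (Finset.subset_singleton_iff.mp fun k hk => ?_).resolve_left hS.ne_empty
      by_contra h
      exact Finset.notMem_empty k (he ▸ Finset.mem_erase.mpr ⟨by simpa using h, hk⟩)
    subst hSM
    exact ⟨by simp, fun k hk hkM => absurd (Finset.mem_singleton.mp hk) hkM⟩
  obtain ⟨j, hj, hmax⟩ := (S.erase M).exists_max_image β hne
  obtain ⟨hjM, hjS⟩ := Finset.mem_erase.mp hj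
  have hjpos := hβ j hjS
  obtain ⟨i, hi⟩ := Function.ne_iff.mp hjM
  -- The largest competitor `j` differs from `M` in some coordinate `i`, so concentration in that
  -- one direction suffices.
  have h1 : β j ^ 2 ≤ (2 * s) ^ 2 * ∑ k ∈ S, β k ^ 2 := by
    refine (Finset.single_le_sum (f := fun k => β k ^ 2) (fun _ _ => by positivity)
      (Finset.mem_filter.mpr ⟨hjS, hi⟩)).trans ((hM i).trans ?_)
    gcongr
    exact Finset.filter_subset _ _
  have h2 : ∑ k ∈ S.erase M, β k ^ 2 ≤ D * β j ^ 2 := by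
    calc _ ≤ ∑ k ∈ S.erase M, β j ^ 2 := Finset.sum_le_sum fun k hk => by
          have := (hβ k (Finset.mem_of_mem_erase hk)).le
          gcongr
          exact hmax k hk
      _ ≤ _ := by
          rw [Finset.sum_const, nsmul_eq_mul]
          gcongr
          exact le_trans (by exact_mod_cast Finset.card_le_card (Finset.erase_subset _ _)) hD
  have hsD : 2 * s * D ≤ 3 / 8 := by
    rw [le_div_iff₀ (by positivity)] at hs
    linarith
  have h3 : (2 * s * D) ^ 2 ≤ (3 / 8) ^ 2 := by gcongr
  have h4 : (D * β j) ^ 2 ≤ (3 / 8) ^ 2 * ∑ k ∈ S, β k ^ 2 := by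
    calc (D * β j) ^ 2 = D ^ 2 * β j ^ 2 := by ring
      _ ≤ D ^ 2 * ((2 * s) ^ 2 * ∑ k ∈ S, β k ^ 2) := by gcongr
      _ = (2 * s * D) ^ 2 * ∑ k ∈ S, β k ^ 2 := by ring
      _ ≤ _ := by
        gcongr
  have h5 : D * β j ^ 2 ≤ (D * β j) ^ 2 := by nlinarith [sq_nonneg (β j)]
  have h6 : 0 < (D * β j) ^ 2 := by positivity
  have hMS : M ∈ S := by
    by_contra h
    rw [Finset.erase_eq_of_notMem h] at h2
    nlinarith
  refine ⟨hMS, fun k hk hkM => ?_⟩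
  have hMpos := hβ M hMS
  rw [← Finset.add_sum_erase _ _ hMS] at h4
  -- With `x = (D β_j)^2`, the bounds give `x ≤ (9/64)(β_M^2 + x)`, hence `x ≤ (9/55) β_M^2`.
  have h7 : D * β j < β M := lt_of_pow_lt_pow_left₀ 2 hMpos.le (by nlinarith)
  refine lt_of_le_of_lt ?_ h7
  gcongr
  exact hmax k (Finset.mem_erase.mpr ⟨hkM, hk⟩)

/-- Every `k ≠ M` is counted in some direction. Adding the `r` inequalities gives `T ≤ (β_M^2 + T) /
(4r)`, and `4r - 1 ≥ 3r`. -/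
lemma sum_sq_erase_le_of_concentrated (hr : 0 < r) {S : Finset (Fin r → ℤ)}
    {β : (Fin r → ℤ) → ℝ} {M : Fin r → ℤ}
    (hM : ∀ i, ∑ k ∈ S with k i ≠ M i, β k ^ 2 ≤
      (2 * (1 / (4 * r))) ^ 2 * ∑ k ∈ S with k i = M i, β k ^ 2) :
    ∑ k ∈ S.erase M, β k ^ 2 ≤ 1 / (3 * r) * β M ^ 2 := by
  classical
  have hr' : (1 : ℝ) ≤ r := by exact_mod_cast hr
  set T := ∑ k ∈ S.erase M, β k ^ 2
  have hall : ∑ k ∈ S, β k ^ 2 ≤ β M ^ 2 + T := by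
    by_cases h : M ∈ S
    · exact (Finset.add_sum_erase _ _ h).ge
    · have : T = ∑ k ∈ S, β k ^ 2 := by simp only [T, Finset.erase_eq_of_notMem h]
      rw [this]
      nlinarith [sq_nonneg (β M)]
  have h1 : T ≤ ∑ i, ∑ k ∈ S with k i ≠ M i, β k ^ 2 := by
    simp only [Finset.sum_filter]
    rw [Finset.sum_comm]
    refine (Finset.sum_le_sum fun k hk => ?_).trans
      (Finset.sum_le_sum_of_subset_of_nonneg (Finset.erase_subset M S) fun k _ _ =>
        Finset.sum_nonneg fun i _ => by split_ifs <;> positivity)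
    obtain ⟨i, hi⟩ := Function.ne_iff.mp (Finset.ne_of_mem_erase hk)
    refine le_trans ?_ (Finset.single_le_sum (f := fun i => if k i ≠ M i then β k ^ 2 else 0)
      (fun i _ => by split_ifs <;> positivity) (Finset.mem_univ i))
    simp [hi]
  have h2 : T ≤ 1 / (4 * r) * (β M ^ 2 + T) := by
    calc T ≤ ∑ i : Fin r, (2 * (1 / (4 * (r : ℝ)))) ^ 2 * (β M ^ 2 + T) := by
          refine h1.trans (Finset.sum_le_sum fun i _ => (hM i).trans ?_)
          gcongr
          refine le_trans ?_ hall
          exact Finset.sum_le_sum_of_subset_of_nonneg (Finset.filter_subset _ _)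
            fun _ _ _ => by positivity
      _ = _ := by
          rw [Finset.sum_const, Finset.card_univ, Fintype.card_fin, nsmul_eq_mul]
          field_simp
          ring
  have hT : 0 ≤ T := Finset.sum_nonneg fun _ _ => by positivity
  rw [div_mul_eq_mul_div, le_div_iff₀ (by positivity)] at h2 ⊢
  nlinarith

/-! ### Geometric decay away from the dominant exponent. -/

/-- The supremum norm of an integral vector. -/
def supAbs (κ : Fin r → ℤ) : ℕ := Finset.univ.sup fun j => (κ j).natAbs

lemma natAbs_le_supAbs (κ : Fin r → ℤ) (j : Fin r) : (κ j).natAbs ≤ supAbs κ :=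
  Finset.le_sup (f := fun j => (κ j).natAbs) (Finset.mem_univ j)

lemma exists_natAbs_eq_supAbs (hr : 0 < r) (κ : Fin r → ℤ) : ∃ j, (κ j).natAbs = supAbs κ := by
  have : Nonempty (Fin r) := ⟨⟨0, hr⟩⟩
  obtain ⟨j, -, hj⟩ := Finset.exists_mem_eq_sup Finset.univ Finset.univ_nonempty
    fun j => (κ j).natAbs
  exact ⟨j, hj.symm⟩

lemma card_filter_supAbs_le (S : Finset (Fin r → ℤ)) (m : ℕ) :
    (S.filter fun κ => supAbs κ = m).card ≤ (2 * m + 1) ^ r := by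
  calc _ ≤ (Fintype.piFinset fun _ : Fin r => Finset.Icc (-(m : ℤ)) m).card := by
        refine Finset.card_le_card fun κ hκ => ?_
        rw [Fintype.mem_piFinset]
        intro j
        have h1 := natAbs_le_supAbs κ j
        rw [(Finset.mem_filter.mp hκ).2] at h1
        rw [Finset.mem_Icc]
        omega
    _ = _ := by
        rw [Fintype.card_piFinset_const, Int.card_Icc]
        congr 1
        omega

/-- At most `(2m+1)^r ≤ 3^{mr}` vectors have supremum norm `m`, so they contribute at most `2^{-m}`.
-/
lemma sum_inv_pow_supAbs_le_one {Λ : ℝ} (hΛ : 2 * 3 ^ r ≤ Λ) (S : Finset (Fin r → ℤ))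
    (hS : ∀ κ ∈ S, supAbs κ ≠ 0) : ∑ κ ∈ S, (Λ ^ supAbs κ)⁻¹ ≤ 1 := by
  have hΛ0 : 0 < Λ := lt_of_lt_of_le (by positivity) hΛ
  set L := S.sup supAbs
  have hmaps : ∀ κ ∈ S, supAbs κ ∈ Finset.Ioc 0 L := fun κ hκ =>
    Finset.mem_Ioc.mpr ⟨Nat.pos_of_ne_zero (hS κ hκ), Finset.le_sup hκ⟩
  rw [← Finset.sum_fiberwise_of_maps_to hmaps]
  have hpow : ∀ m : ℕ, 2 * m + 1 ≤ 3 ^ m := fun m => by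
    have := one_add_mul_le_pow (a := (2 : ℤ)) (by norm_num) m
    norm_num at this
    zify
    linarith
  have hterm : ∀ m ∈ Finset.Ioc 0 L, ∑ κ ∈ S with supAbs κ = m, (Λ ^ supAbs κ)⁻¹ ≤ (1 / 2) ^ m := by
    intro m _
    calc _ = ∑ κ ∈ S with supAbs κ = m, (Λ ^ m)⁻¹ :=
          Finset.sum_congr rfl fun κ hκ => by rw [(Finset.mem_filter.mp hκ).2]
      _ = ((S.filter fun κ => supAbs κ = m).card : ℝ) * (Λ ^ m)⁻¹ := by
          rw [Finset.sum_const, nsmul_eq_mul]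
      _ ≤ ((3 : ℝ) ^ m) ^ r * ((2 * 3 ^ r) ^ m)⁻¹ := by
          gcongr
          have h1 := (card_filter_supAbs_le S m).trans (Nat.pow_le_pow_left (hpow m) r)
          exact_mod_cast h1
      _ = _ := by
          rw [mul_pow, ← pow_mul, ← pow_mul, mul_comm m r, one_div, inv_pow]
          field_simp
  refine (Finset.sum_le_sum hterm).trans ?_
  have hgeom : ∀ L : ℕ, ∑ m ∈ Finset.Ioc 0 L, (1 / 2 : ℝ) ^ m = 1 - (1 / 2) ^ L := by
    intro L
    induction L with
    | zero => simp
    | succ L ih => rw [Finset.sum_Ioc_succ_top (Nat.zero_le L), ih]; ring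
  rw [hgeom]
  have : (0 : ℝ) ≤ (1 / 2) ^ L := by positivity
  linarith

/-- This is where the constant `(r+3) 2^{r+1}` comes from. For `r ≥ 8` already `8·3^r ≤ 4^r`; for
smaller `r` the factor `(r+3)/r` makes up the deficit. -/
lemma two_mul_three_pow_le (hr : 0 < r) :
    2 * (3 : ℝ) ^ r ≤ (((r : ℝ) + 3) * 2 ^ (r + 1) / (4 * r)) ^ 2 := by
  have hr' : (0 : ℝ) < r := by exact_mod_cast hr
  have h4 : ((2 : ℝ) ^ (r + 1)) ^ 2 = 4 * 4 ^ r := by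
    rw [← pow_mul, mul_comm, pow_mul]; norm_num [pow_succ]; ring
  rw [div_pow, le_div_iff₀ (by positivity), mul_pow _ ((2 : ℝ) ^ (r + 1)), h4]
  rcases le_or_gt r 7 with h | h
  · interval_cases r <;> norm_num
  · have h8 : ∀ m : ℕ, 8 * (3 : ℝ) ^ (8 + m) ≤ 4 ^ (8 + m) := by
      intro m
      induction m with
      | zero => norm_num
      | succ m ih =>
        rw [← add_assoc, pow_succ, pow_succ]
        have : (0 : ℝ) < 3 ^ (8 + m) := by positivity
        linarith
    have h9 := h8 (r - 8)
    rw [Nat.add_sub_cancel' h] at h9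
    have h10 : (r : ℝ) ^ 2 ≤ (r + 3) ^ 2 := by gcongr; linarith
    calc 2 * (3 : ℝ) ^ r * (4 * r) ^ 2 = 4 * ((r : ℝ) ^ 2 * (8 * 3 ^ r)) := by ring
      _ ≤ 4 * (((r : ℝ) + 3) ^ 2 * 4 ^ r) := by gcongr
      _ = _ := by ring

/-- Moving `a` by `±τ` along axis `j` changes the ratio of term `k` to term `M` by `e^{±τ(k_j -
M_j)}`. With `κ = (k - M)/n` and `Λ = e^{2nτ}`, adding the `2r` shifted inequalities bounds the sum
of squares weighted by `Λ^{|κ|}` by `2r/(3r) = 2/3` of the `M`-th square. Cauchy–Schwarz against the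
weights `Λ^{-|κ|}`, of sum at most `1`, finishes. -/
lemma sum_erase_lt_of_concentrated (hr : 0 < r) {g : LaurentPoly r} (hg : g.coeff.support.Nonempty)
    {n : ℕ} (hdvd : ∀ k ∈ g.coeff.support, ∀ i, (n : ℤ) ∣ k i)
    {a : EuclideanSpace ℝ (Fin r)} {τ : ℝ} (hτ : 0 ≤ τ)
    (hexp : 2 * 3 ^ r ≤ Real.exp (n * τ) ^ 2) {M : Fin r → ℤ}
    (hM : ∀ i v, dist v a ≤ τ → ∑ k ∈ g.coeff.support with k i ≠ M i, termSize g v k ^ 2 ≤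
      (2 * (1 / (4 * r))) ^ 2 * ∑ k ∈ g.coeff.support with k i = M i, termSize g v k ^ 2) :
    M ∈ g.coeff.support ∧ ∑ k ∈ g.coeff.support.erase M, termSize g a k < termSize g a M := by
  classical
  set S := g.coeff.support
  have hr' : (0 : ℝ) < r := by exact_mod_cast hr
  have hconc : ∀ v, dist v a ≤ τ →
      ∑ k ∈ S.erase M, termSize g v k ^ 2 ≤ 1 / (3 * r) * termSize g v M ^ 2 := fun v hv =>
    sum_sq_erase_le_of_concentrated hr fun i => hM i v hv
  have hMS : M ∈ S := by
    by_contra h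
    have h1 := hconc a (by simpa using hτ)
    rw [Finset.erase_eq_of_notMem h, termSize_eq_zero a h] at h1
    have : 0 < ∑ k ∈ S, termSize g a k ^ 2 :=
      Finset.sum_pos (fun k hk => pow_pos (termSize_pos a hk) 2) hg
    norm_num at h1
    linarith
  refine ⟨hMS, ?_⟩
  have hMpos : 0 < termSize g a M := termSize_pos a hMS
  have hshift : ∀ (j : Fin r) (t : ℝ), |t| ≤ τ →
      ∑ k ∈ S.erase M, termSize g a k ^ 2 * Real.exp (2 * t * (k j - M j)) ≤
        1 / (3 * r) * termSize g a M ^ 2 := by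
    intro j t ht
    have h1 := hconc (a + EuclideanSpace.single j t) (by
      rw [dist_self_add_left, PiLp.norm_single, Real.norm_eq_abs]; exact ht)
    simp only [termSize_add_single, mul_pow, ← Real.exp_nat_mul] at h1
    -- Normalises by the squared shift factor of the term `M`.
    have h2 := mul_le_mul_of_nonneg_right h1 (Real.exp_nonneg (-(2 * t * M j)))
    rw [Finset.sum_mul] at h2
    refine (le_of_eq (Finset.sum_congr rfl fun k _ => ?_)).trans (h2.trans (le_of_eq ?_))
    · rw [mul_assoc (termSize g a k ^ 2), ← Real.exp_add]
      congr 2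
      push_cast
      ring
    · rw [mul_assoc, mul_assoc, ← Real.exp_add]
      have : ((2 : ℕ) : ℝ) * (M j * t) + -(2 * t * M j) = 0 := by push_cast; ring
      rw [this, Real.exp_zero, mul_one]
  let κ : (Fin r → ℤ) → Fin r → ℤ := fun k j => (k j - M j) / n
  have hκ : ∀ k ∈ S, ∀ j, ((k j : ℝ) - M j) = n * κ k j := by
    intro k hk j
    have := Int.mul_ediv_cancel' (dvd_sub (hdvd k hk j) (hdvd M hMS j))
    exact_mod_cast this.symm
  set Λ := Real.exp (n * τ) ^ 2 with hΛ
  have hΛ0 : 0 < Λ := by positivity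
  have hweight : ∀ k ∈ S, Λ ^ supAbs (κ k) ≤
      ∑ j, (Real.exp (2 * τ * (k j - M j)) + Real.exp (2 * (-τ) * (k j - M j))) := by
    intro k hk
    obtain ⟨j, hj⟩ := exists_natAbs_eq_supAbs hr (κ k)
    refine le_trans ?_ (Finset.single_le_sum
      (f := fun j => Real.exp (2 * τ * (k j - M j)) + Real.exp (2 * (-τ) * (k j - M j)))
      (fun _ _ => by positivity) (Finset.mem_univ j))
    rw [hκ k hk j, ← hj, hΛ, ← pow_mul, ← Real.exp_nat_mul]
    have hcast : (((κ k j).natAbs : ℕ) : ℝ) = |(κ k j : ℝ)| := by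
      rw [Nat.cast_natAbs, Int.cast_abs]
    push_cast
    rw [hcast]
    rcases abs_choice (κ k j : ℝ) with h | h
    · rw [h]
      refine le_trans (le_of_eq ?_) (le_add_of_nonneg_right (Real.exp_nonneg _))
      congr 1
      ring
    · rw [h]
      refine le_trans (le_of_eq ?_) (le_add_of_nonneg_left (Real.exp_nonneg _))
      congr 1
      ring
  have hW : ∑ k ∈ S.erase M, termSize g a k ^ 2 * Λ ^ supAbs (κ k) ≤ 2 / 3 * termSize g a M ^ 2 := by
    calc _ ≤ ∑ k ∈ S.erase M, termSize g a k ^ 2 *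
          ∑ j, (Real.exp (2 * τ * (k j - M j)) + Real.exp (2 * (-τ) * (k j - M j))) :=
          Finset.sum_le_sum fun k hk => mul_le_mul_of_nonneg_left
            (hweight k (Finset.mem_of_mem_erase hk)) (by positivity)
      _ = ∑ j, (∑ k ∈ S.erase M, termSize g a k ^ 2 * Real.exp (2 * τ * (k j - M j)) +
          ∑ k ∈ S.erase M, termSize g a k ^ 2 * Real.exp (2 * (-τ) * (k j - M j))) := by
          simp only [Finset.mul_sum, ← Finset.sum_add_distrib, mul_add]
          rw [Finset.sum_comm]
      _ ≤ ∑ j : Fin r, (1 / (3 * (r : ℝ)) * termSize g a M ^ 2 +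
            1 / (3 * (r : ℝ)) * termSize g a M ^ 2) :=
          Finset.sum_le_sum fun j _ => add_le_add (hshift j τ (by rw [abs_of_nonneg hτ]))
            (hshift j (-τ) (by rw [abs_neg, abs_of_nonneg hτ]))
      _ = _ := by
          rw [Finset.sum_const, Finset.card_univ, Fintype.card_fin, nsmul_eq_mul]
          field_simp
          ring
  have hinj : Set.InjOn κ (S.erase M : Finset _) := by
    intro k hk l hl hkl
    ext j
    have h1 := hκ k (Finset.mem_of_mem_erase hk) j
    have h2 := hκ l (Finset.mem_of_mem_erase hl) j
    rw [hkl, ← h2] at h1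
    have : (k j : ℝ) = l j := by linarith
    exact_mod_cast this
  have hV : ∑ k ∈ S.erase M, (Λ ^ supAbs (κ k))⁻¹ ≤ 1 := by
    rw [← Finset.sum_image (g := κ) (f := fun κ => (Λ ^ supAbs κ)⁻¹) hinj]
    refine sum_inv_pow_supAbs_le_one hexp _ fun x hx hx0 => ?_
    obtain ⟨k, hk, rfl⟩ := Finset.mem_image.mp hx
    obtain ⟨hkM, hkS⟩ := Finset.mem_erase.mp hk
    refine hkM (funext fun j => ?_)
    have h1 := natAbs_le_supAbs (κ k) j
    rw [hx0, Nat.le_zero, Int.natAbs_eq_zero] at h1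
    have h2 := hκ k hkS j
    rw [h1, Int.cast_zero, mul_zero, sub_eq_zero] at h2
    exact_mod_cast h2
  have hCS := Finset.sum_sq_le_sum_mul_sum_of_sq_le_mul (S.erase M)
    (r := fun k => termSize g a k) (f := fun k => termSize g a k ^ 2 * Λ ^ supAbs (κ k))
    (g := fun k => (Λ ^ supAbs (κ k))⁻¹) (fun k _ => by positivity) (fun k _ => by positivity)
    (fun k _ => le_of_eq (by field_simp))
  refine lt_of_pow_lt_pow_left₀ 2 hMpos.le (hCS.trans_lt ?_)
  have hV0 : 0 ≤ ∑ k ∈ S.erase M, (Λ ^ supAbs (κ k))⁻¹ :=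
    Finset.sum_nonneg fun _ _ => by positivity
  calc _ ≤ 2 / 3 * termSize g a M ^ 2 * 1 := by gcongr
    _ < _ := by nlinarith [pow_pos hMpos 2]

/-! ### Translation to lists, nonvanishing, and elementary estimates. -/

lemma isLopsided_termSizes {g : LaurentPoly r} {a : EuclideanSpace ℝ (Fin r)} {M : Fin r → ℤ}
    (hM : M ∈ g.coeff.support)
    (h : ∑ k ∈ g.coeff.support.erase M, termSize g a k < termSize g a M) :
    IsLopsided (termSizes g a) := by
  refine ⟨⟨M, hM⟩, ?_⟩
  simp only [termSizes_eq]
  have h1 := Finset.add_sum_erase Finset.univ (fun k : g.coeff.support => termSize g a k)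
    (Finset.mem_univ ⟨M, hM⟩)
  have h2 := Finset.add_sum_erase _ (fun k => termSize g a k) hM
  have h3 := Finset.sum_coe_sort g.coeff.support (fun k => termSize g a k)
  simp only at h1 h2
  linarith

lemma sum_erase_lt_of_mul_lt {g : LaurentPoly r} {a : EuclideanSpace ℝ (Fin r)} {M : Fin r → ℤ}
    (hM : M ∈ g.coeff.support) {D : ℝ} (hD : (g.coeff.support.card : ℝ) ≤ D)
    (h : ∀ k ∈ g.coeff.support, k ≠ M → D * termSize g a k < termSize g a M) :
    ∑ k ∈ g.coeff.support.erase M, termSize g a k < termSize g a M := by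
  have hMpos : 0 < termSize g a M := termSize_pos a hM
  have hcard : (0 : ℝ) < g.coeff.support.card := by exact_mod_cast Finset.card_pos.mpr ⟨M, hM⟩
  have hDpos : 0 < D := hcard.trans_le hD
  have h1 : ∑ k ∈ g.coeff.support.erase M, D * termSize g a k ≤
      ((g.coeff.support.card : ℝ) - 1) * termSize g a M := by
    calc _ ≤ ∑ k ∈ g.coeff.support.erase M, termSize g a M := Finset.sum_le_sum fun k hk =>
          (h k (Finset.mem_of_mem_erase hk) (Finset.ne_of_mem_erase hk)).le
      _ = _ := by
          rw [Finset.sum_const, nsmul_eq_mul, Finset.card_erase_of_mem hM,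
            Nat.cast_sub (Finset.card_pos.mpr ⟨M, hM⟩), Nat.cast_one]
  rw [← Finset.mul_sum] at h1
  refine lt_of_mul_lt_mul_left (h1.trans_lt ?_) hDpos.le
  nlinarith

lemma isSuperlopsided_termSizes {g : LaurentPoly r} {a : EuclideanSpace ℝ (Fin r)}
    {M : Fin r → ℤ} (hM : M ∈ g.coeff.support) {D : ℝ} (hD : (g.coeff.support.card : ℝ) ≤ D)
    (h : ∀ k ∈ g.coeff.support, k ≠ M → D * termSize g a k < termSize g a M) :
    IsSuperlopsided (termSizes g a) ∧ IsSuperlopsidedWith D (termSizes g a) := by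
  have hlt : ∀ j : g.coeff.support, j ≠ ⟨M, hM⟩ →
      D * termSizes g a j < termSizes g a ⟨M, hM⟩ := by
    intro j hj
    rw [termSizes_eq, termSizes_eq]
    exact h j j.2 fun hjM => hj (Subtype.ext hjM)
  refine ⟨⟨by simp, ⟨M, hM⟩, fun j hj => lt_of_le_of_lt ?_ (hlt j hj)⟩,
    by rw [Fintype.card_coe]; linarith, ⟨M, hM⟩, hlt⟩
  rw [Fintype.card_coe]
  refine mul_le_mul_of_nonneg_right (by linarith) ?_
  rw [termSizes_eq]
  exact termSize_nonneg _ _ _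

lemma cyclicResultant_ne_zero {f : LaurentPoly r} {ξ : Fin r → ℂ} (n : ℕ)
    (h : ∀ η : Fin r → ℂ, reVec η = reVec ξ → expEval η f ≠ 0) : cyclicResultant f n ≠ 0 := by
  intro h0
  have h1 := expEval_cyclicResultant ξ f n
  rw [h0, map_zero, eq_comm, Finset.prod_eq_zero_iff] at h1
  obtain ⟨k, -, hk⟩ := h1
  exact h _ (by rw [map_add, reVec_rootAngle, add_zero]) hk

lemma pow_mul_le_exp_of_log_le {n : ℕ} (hn : 0 < n) {p : ℕ} {X y : ℝ} (hX : 0 < X)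
    (h : p * Real.log n + Real.log X ≤ y) : (n : ℝ) ^ p * X ≤ Real.exp y := by
  have hn' : (0 : ℝ) < n := by exact_mod_cast hn
  rw [← Real.log_le_iff_le_exp (by positivity), Real.log_mul (by positivity) hX.ne', Real.log_pow]
  exact h

lemma one_le_maxWidth {f : LaurentPoly r} (hf : ¬ (f.coeff.support : Set (Fin r → ℤ)).Subsingleton) :
    1 ≤ maxWidth f := by
  rw [Set.not_subsingleton_iff] at hf
  obtain ⟨k, hk, l, hl, hkl⟩ := hf
  obtain ⟨i, hi⟩ := Function.ne_iff.mp hkl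
  have h1 := sub_le_maxWidth f hk hl i
  have h2 := sub_le_maxWidth f hl hk i
  rcases lt_or_gt_of_ne hi with h | h
  · refine le_trans ?_ h2
    exact_mod_cast (by omega : (1 : ℤ) ≤ l i - k i)
  · refine le_trans ?_ h1
    exact_mod_cast (by omega : (1 : ℤ) ≤ k i - l i)

end CyclicAmoeba

end

/-! ### The theorem. -/

open CyclicAmoeba in
theorem theorem3p5 {r : ℕ} (hr : 0 < r) (f : CyclicAmoeba.LaurentPoly r)
    (ε : ℝ) (hε : 0 < ε)
    (a : EuclideanSpace ℝ (Fin r)) (ha : a ∉ CyclicAmoeba.amoeba f)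
    (hdist : ENNReal.ofReal ε ≤ Metric.infEDist a (CyclicAmoeba.amoeba f))
    (d : ℝ) (hd : CyclicAmoeba.IsLatticeBound (CyclicAmoeba.newtonPolytope f) d)
    (c : ℝ) (hc : c = CyclicAmoeba.maxWidth f)
    (n : ℕ) (hn : 0 < n) :
    -- If `c = 0`, both logarithms of constants mean `-∞` and both conditions on `n` hold.
    ((c = 0 ∨ ((r : ℝ) - 1) * Real.log n + Real.log (((r : ℝ) + 3) * 2 ^ (r + 1) * c) ≤ n * ε) →
      CyclicAmoeba.IsLopsided
        (CyclicAmoeba.termSizes (CyclicAmoeba.cyclicResultant f n) a)) ∧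
    ((c = 0 ∨ ((r : ℝ) ^ 2 - 1) * Real.log n + Real.log (16 / 3 * c * d) ≤ n * ε) →
      CyclicAmoeba.IsSuperlopsided
        (CyclicAmoeba.termSizes (CyclicAmoeba.cyclicResultant f n) a) ∧
      CyclicAmoeba.IsSuperlopsidedWith (d * (n : ℝ) ^ (r ^ 2 - r))
        (CyclicAmoeba.termSizes (CyclicAmoeba.cyclicResultant f n) a)) := by
  have hn' : (0 : ℝ) < n := by exact_mod_cast hn
  have hn1 : (1 : ℝ) ≤ n := by exact_mod_cast hn
  have hr1 : (1 : ℝ) ≤ r := by exact_mod_cast hr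
  have hare : reVec (fun i => (a i : ℂ)) = a := by ext j; simp
  have hnv : ∀ η : Fin r → ℂ, reVec η = reVec (fun i => (a i : ℂ)) → expEval η f ≠ 0 :=
    fun η hη => expEval_ne_zero hdist (by rw [hη, hare, dist_self]; exact hε)
  have hf0 : f ≠ 0 := by
    rintro rfl
    exact hnv _ rfl (map_zero _)
  have hg0 := cyclicResultant_ne_zero n hnv
  have hgS : (cyclicResultant f n).coeff.support.Nonempty := by
    simpa [Finset.nonempty_iff_ne_empty] using hg0
  have hcard := card_support_cyclicResultant_le hr f hf0 n hn hd
  set D := d * (n : ℝ) ^ (r ^ 2 - r) with hDdef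
  have hD1 : 1 ≤ D := le_trans (by exact_mod_cast hgS.card_pos) hcard
  have hsuper : ∀ c' : ℝ, 0 ≤ c' → (∀ i, ∀ k ∈ f.coeff.support, ∀ l ∈ f.coeff.support,
      ((k i - l i : ℤ) : ℝ) ≤ c') → n ^ (r - 1) * (c' * Real.exp (-(n * ε))) ≤ 3 / (16 * D) →
      ∃ M ∈ (cyclicResultant f n).coeff.support, ∀ k ∈ (cyclicResultant f n).coeff.support,
        k ≠ M → D * termSize (cyclicResultant f n) a k < termSize (cyclicResultant f n) a M := by
    intro c' hc0 hc' hs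
    have hs4 : n ^ (r - 1) * (c' * Real.exp (-(n * ε))) ≤ 1 / 4 := by
      refine hs.trans ?_
      rw [div_le_iff₀ (by positivity)]
      linarith
    have hdom := fun i => exists_dominant_exponent hn f i (hc' i) hdist le_rfl hε hs4
      (by rw [sub_zero])
    choose M hM using hdom
    exact ⟨M, mul_lt_of_concentrated hgS (fun k hk => termSize_pos a hk) hcard (by positivity) hs
      fun i => hM i a (by simp)⟩
  -- For a single monomial the width bound `0` makes the error vanish, whatever `n`; otherwise
  -- integrality of exponents gives `c ≥ 1`.
  by_cases hsub : (f.coeff.support : Set (Fin r → ℤ)).Subsingleton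
  · obtain ⟨M, hMS, hM⟩ := hsuper 0 le_rfl (fun i k hk l hl => by rw [hsub hk hl]; simp)
      (by rw [zero_mul, mul_zero]; positivity)
    exact ⟨fun _ => isLopsided_termSizes hMS (sum_erase_lt_of_mul_lt hMS hcard hM),
      fun _ => isSuperlopsided_termSizes hMS hcard hM⟩
  have hc1 : 1 ≤ c := hc ▸ one_le_maxWidth hsub
  have hwidth : ∀ i, ∀ k ∈ f.coeff.support, ∀ l ∈ f.coeff.support, ((k i - l i : ℤ) : ℝ) ≤ c :=
    fun i k hk l hl => hc ▸ sub_le_maxWidth f hk hl i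
  have hEpos := Real.exp_pos (n * ε)
  constructor
  · intro h
    have hlog := h.resolve_left (by linarith)
    have hrcast : ((r : ℝ) - 1) = ((r - 1 : ℕ) : ℝ) := by rw [Nat.cast_sub hr, Nat.cast_one]
    rw [hrcast] at hlog
    have hE := pow_mul_le_exp_of_log_le hn (by positivity) hlog
    set P : ℝ := (n : ℝ) ^ (r - 1)
    have hP1 : 1 ≤ P := one_le_pow₀ hn1
    set K : ℝ := ((r : ℝ) + 3) * 2 ^ (r + 1)
    have hKr : 4 * (r : ℝ) ≤ K := by
      have h2 : (4 : ℝ) ≤ 2 ^ (r + 1) := by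
        calc (4 : ℝ) = 2 ^ (1 + 1) := by norm_num
          _ ≤ _ := pow_le_pow_right₀ one_le_two (by omega)
      nlinarith
    have hKpos : 0 < K := by positivity
    set lam := K / (4 * r) with hlam
    have hlam1 : 1 ≤ lam := by rw [hlam, one_le_div (by positivity)]; exact hKr
    have hlamK : lam < K := by
      rw [hlam, div_lt_iff₀ (by positivity)]
      nlinarith
    -- Chosen so that `e^{nτ} = K/(4r)`: the hypothesis `n^{r-1} K c ≤ e^{nε}` then gives exactly `s
    -- ≤ 1/(4r)`, and `e^{2nτ}` reaches `2·3^r`.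
    set τ := Real.log lam / n with hτdef
    have hnτ : n * τ = Real.log lam := by rw [hτdef]; field_simp
    have hexpτ : Real.exp (n * τ) = lam := by rw [hnτ, Real.exp_log (by linarith)]
    have hτ0 : 0 ≤ τ := div_nonneg (Real.log_nonneg hlam1) hn'.le
    have hKE : K ≤ Real.exp (n * ε) := by
      refine le_trans ?_ hE
      have : 1 * K ≤ P * c * K := by
        gcongr
        nlinarith
      nlinarith
    have hτε : τ < ε := by
      have : Real.exp (n * τ) < Real.exp (n * ε) := by rw [hexpτ]; linarith
      exact lt_of_mul_lt_mul_left (Real.exp_lt_exp.mp this) hn'.le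
    have hs4 : 1 / (4 * (r : ℝ)) ≤ 1 / 4 := by
      gcongr
      linarith
    have hcs : P * (c * Real.exp (-(n * (ε - τ)))) ≤ 1 / (4 * r) := by
      have h1 : Real.exp (-(n * (ε - τ))) = lam / Real.exp (n * ε) := by
        rw [← hexpτ, ← Real.exp_sub]
        congr 1
        ring
      rw [h1, hlam, ← mul_div_assoc, ← mul_div_assoc, div_le_iff₀ hEpos]
      calc P * (c * (K / (4 * r))) = 1 / (4 * r) * (P * (K * c)) := by ring
        _ ≤ _ := by gcongr
    have hdom := fun i => exists_dominant_exponent hn f i (hwidth i) hdist hτ0 hτε hs4 hcs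
    choose M hM using hdom
    obtain ⟨hMS, hsum⟩ := sum_erase_lt_of_concentrated hr hgS
      (fun k hk i => dvd_of_mem_support_cyclicResultant f n hn hk i) hτ0
      (by rw [hexpτ]; exact two_mul_three_pow_le hr) hM
    exact isLopsided_termSizes hMS hsum
  · intro h
    have hlog := h.resolve_left (by linarith)
    have hr2 : 1 ≤ r ^ 2 := Nat.one_le_pow _ _ hr
    have hrcast : ((r : ℝ) ^ 2 - 1) = ((r ^ 2 - 1 : ℕ) : ℝ) := by
      rw [Nat.cast_sub hr2, Nat.cast_one, Nat.cast_pow]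
    have hdpos : 0 < d := by
      have : 0 < D := by linarith
      exact pos_of_mul_pos_left this (by positivity)
    rw [hrcast] at hlog
    have hE := pow_mul_le_exp_of_log_le hn (by positivity) hlog
    -- The power `n^{r-1}` counts the products in one direction, and `n^{r^2-r}` comes from the
    -- bound `D` on the number of terms.
    have hpow : (n : ℝ) ^ (r ^ 2 - 1) = (n : ℝ) ^ (r - 1) * (n : ℝ) ^ (r ^ 2 - r) := by
      rw [← pow_add]
      congr 1
      have : r ≤ r ^ 2 := Nat.le_self_pow two_ne_zero r
      omega
    obtain ⟨M, hMS, hM⟩ := hsuper c (by linarith) hwidth (by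
      rw [Real.exp_neg, ← div_eq_mul_inv, ← mul_div_assoc, div_le_div_iff₀ hEpos (by positivity)]
      rw [hpow] at hE
      rw [hDdef]
      calc _ = 3 * ((n : ℝ) ^ (r - 1) * (n : ℝ) ^ (r ^ 2 - r) * (16 / 3 * c * d)) := by ring
        _ ≤ _ := by gcongr)
    exact isSuperlopsided_termSizes hMS hcard hM
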